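/- **Conventions.** For a topological space $X$ let $\pi(X)$ be its set of connected components with the quotient topology, and for a simplicial space $X_\bullet$ let $\pi_0(X_\bullet)=\mathrm{CoEq}(X_1\rightrightarrows X_0)$, the coequaliser being taken in topological spaces. Both are naturally pointed when the argument is pointed. For a category $\mathcal D$ with a functor to simplicial objects, $\mathrm{Ho}(\mathcal D)$ denotes the category obtained by identifying morphisms whose images are (simplicially) homotopic. In particular $\mathrm{Ho}(\mathrm{sTop}_*)$ is obtained from the category of pointed simplicial spaces $(X_\bullet,\Delta[0]\to X_\bullet)$ by identifying base-point-preserving morphisms that are homotopic through a not necessarily pointed homotopy; $\pi_0$ induces a functor $\mathrm{Ho}(\mathrm{sTop}_*)\to\mathrm{Top}_*$. A pro-object of $\mathcal C$ is a functor from a cofiltered category to $\mathcal C$, with $\mathrm{Hom}((X_i),(Y_j))=\lim_j\operatorname{colim}_i\mathrm{Hom}(X_i,Y_j)$. A pointed scheme $(S,s)$ is a scheme $S$ with a geometric point $s\colon\operatorname{Spec}\Omega\to S$, $\Omega$ a separably closed field (in particular $\Omega$ may be algebraically closed). The pro-étale site of $S$ is the category of weakly étale $S$-schemes; a family $\{U_i\to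 X\}$ is a covering if every affine open of $X$ is a finite union of images of quasi-compact opens of the $U_i$. A hypercovering of $S$ is a simplicial object $U_\bullet$ of this site such that $U_0\to S$ and $U_{n+1}\to\mathrm{cosk}_n(U_\bullet)_{n+1}$ ($n\ge 0$) are coverings. A pointed hypercovering $(U_\bullet,u)$ of $(S,s)$ is a hypercovering with a morphism of simplicial sets $u\colon\Delta[0]\to s(U_\bullet)$, where $s(X)=\mathrm{Hom}_S(\operatorname{Spec}\Omega,X)$. With the morphisms that respect base points these form the category $\mathrm{Hy}(S,s)$, and in $\mathrm{Ho}(\mathrm{Hy}(S,s))$ homotopies are not required to be pointed. The pointed pro-étale homotopy type of $(S,s)$ is $$\Pi_{\mathrm{p\acute et}}(S,s)\colon\mathrm{Ho}(\mathrm{Hy}(S,s))\to\mathrm{Ho}(\mathrm{sTop}_*),\qquad (U_\bullet,u)\mapsto\pi(U_\bullet,u),$$ where $\pi$ is applied to the underlying spaces in each degree. **Theorem.** For every pointed scheme $(S,s)$ the category $\mathrm{Ho}(\mathrm{Hy}(S,s))$ is cofiltered, and there is an isomorphism $$\pi\circ\pi_0\circ\Pi_{\mathrm{p\acute et}}(S,s)\;\cong\;\pi(S,s)$$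 of pro-objects of pointed spaces, whose morphism from left to right is, at every pointed hypercovering $(U_\bullet,u)$, represented by the map $\pi(\pi_0(\pi(U_\bullet,u)))\to\pi(S,s)$ induced by $U_0\to S$. It is natural in $(S,s)$: for every morphism $f\colon S'\to S$ with $f\circ s'=s$, all pointed hypercoverings $(U'_\bullet,u')$ of $(S',s')$ and $(U_\bullet,u)$ of $(S,s)$, and every morphism $U'_\bullet\to U_\bullet$ of simplicial schemes over $f$ that respects the base points, the induced square with corners $\pi(\pi_0(\pi(U'_\bullet,u')))$, $\pi(\pi_0(\pi(U_\bullet,u)))$, $\pi(S',s')$, $\pi(S,s)$ commutes. -/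

import Mathlib

open CategoryTheory Limits Opposite Simplicial AlgebraicGeometry

universe w w' v u

noncomputable section

namespace ProEtaleHomotopy

/-! ### Pro-objects

A pro-object of `C` is a functor from a cofiltered category to `C`, and
`Hom(X, Y) = lim_j colim_i Hom(X_i, Y_j)`. -/

/-- A pro-object in a category `C`: a functor into `C` from a cofiltered category. -/
structure ProObject (C : Type u) [Category.{v} C] where
  I : Type w
  [category : Category.{w'} I]
  [isCofiltered : IsCofiltered I]
  diagram : I ⥤ C

namespace ProObject

attribute [instance] ProObject.category ProObject.isCofiltered

variable {C : Type u} [Category.{v} C]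

/-- Two morphisms `X_i ⟶ c` and `X_j ⟶ c` are identified if the second one is the composition of
the first one with a transition morphism `X_j ⟶ X_i`. -/
def germRel (X : ProObject.{w, w'} C) (c : C) (a b : Σ i : X.I, (X.diagram.obj i ⟶ c)) : Prop :=
  ∃ φ : b.1 ⟶ a.1, b.2 = X.diagram.map φ ≫ a.2

/-- The set `colim_i Hom(X_i, c)`. -/
def Germ (X : ProObject.{w, w'} C) (c : C) : Type (max w v) :=
  Quot (germRel X c)

namespace Germ

/-- The element of `colim_i Hom(X_i, c)` represented by a morphism `X_i ⟶ c`. -/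
def mk {X : ProObject.{w, w'} C} {c : C} (i : X.I) (f : X.diagram.obj i ⟶ c) : Germ X c :=
  Quot.mk _ ⟨i, f⟩

/-- Functoriality of `colim_i Hom(X_i, c)` in `c`. -/
def push {X : ProObject.{w, w'} C} {c d : C} (g : c ⟶ d) : Germ X c → Germ X d :=
  Quot.map (fun a ↦ ⟨a.1, a.2 ≫ g⟩) (by
    rintro ⟨i, f⟩ ⟨j, f'⟩ ⟨φ, h⟩
    refine ⟨φ, ?_⟩
    dsimp at φ h ⊢
    rw [h, Category.assoc])

lemma push_mk {X : ProObject.{w, w'} C} {c d : C} (g : c ⟶ d) (i : X.I)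
    (f : X.diagram.obj i ⟶ c) : push g (mk i f) = mk i (f ≫ g) := rfl

lemma push_id {X : ProObject.{w, w'} C} {c : C} (x : Germ X c) : push (𝟙 c) x = x := by
  obtain ⟨i, f⟩ := x
  exact congrArg (mk i) (Category.comp_id f)

lemma push_push {X : ProObject.{w, w'} C} {c d e : C} (g : c ⟶ d) (h : d ⟶ e) (x : Germ X c) :
    push h (push g x) = push (g ≫ h) x := by
  obtain ⟨i, f⟩ := x
  exact congrArg (mk i) (Category.assoc f g h)

lemma mk_map {X : ProObject.{w, w'} C} {c : C} {i j : X.I} (φ : i ⟶ j)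
    (f : X.diagram.obj j ⟶ c) : mk i (X.diagram.map φ ≫ f) = mk j f :=
  (Quot.sound ⟨φ, rfl⟩).symm

end Germ

/-- A morphism of pro-objects: an element of `lim_j colim_i Hom(X_i, Y_j)`. -/
@[ext]
structure Hom (X Y : ProObject.{w, w'} C) where
  app (j : Y.I) : Germ X (Y.diagram.obj j)
  naturality {j k : Y.I} (φ : j ⟶ k) : Germ.push (Y.diagram.map φ) (app j) = app k

/-- The action of a morphism `X ⟶ Y` of pro-objects on `colim_j Hom(Y_j, c)`. -/
def Hom.pull {X Y : ProObject.{w, w'} C} (s : Hom X Y) {c : C} : Germ Y c → Germ X c :=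
  Quot.lift (fun a ↦ Germ.push a.2 (s.app a.1)) (by
    rintro ⟨j, g⟩ ⟨k, g'⟩ ⟨φ, h⟩
    dsimp at φ h ⊢
    rw [h, ← s.naturality φ, Germ.push_push])

lemma Hom.pull_push {X Y : ProObject.{w, w'} C} (s : Hom X Y) {c d : C} (g : c ⟶ d)
    (x : Germ Y c) : Germ.push g (s.pull x) = s.pull (Germ.push g x) := by
  obtain ⟨j, f⟩ := x
  exact Germ.push_push f g (s.app j)

instance : Category (ProObject.{w, w'} C) where
  Hom := Hom
  id X :=
    { app := fun j ↦ Germ.mk j (𝟙 _)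
      naturality := by
        intro j k φ
        rw [Germ.push_mk, Category.id_comp, ← Germ.mk_map φ (𝟙 _), Category.comp_id] }
  comp s t :=
    { app := fun k ↦ s.pull (t.app k)
      naturality := by
        intro j k φ
        rw [Hom.pull_push, t.naturality] }
  id_comp := by
    intro X Y s
    refine Hom.ext (funext fun j ↦ ?_)
    obtain ⟨⟨i, f⟩, h⟩ := Quot.exists_rep (s.app j)
    dsimp only
    rw [← h]
    exact congrArg (Germ.mk i) (Category.id_comp f)
  comp_id := by
    intro X Y s
    exact Hom.ext (funext fun j ↦ Germ.push_id _)
  assoc := by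
    intro W X Y Z s t r
    refine Hom.ext (funext fun k ↦ ?_)
    obtain ⟨⟨j, g⟩, h⟩ := Quot.exists_rep (r.app k)
    dsimp only
    rw [← h]
    exact s.pull_push g (t.app j)

/-- The category with one object and one morphism. -/
def PointIndex : Type w := PUnit.{w + 1}

/-- The object of the category with one object and one morphism. -/
def PointIndex.star : PointIndex.{w} := PUnit.unit

instance : Category.{w'} PointIndex.{w} where
  Hom _ _ := PUnit.{w' + 1}
  id _ := PUnit.unit
  comp _ _ := PUnit.unit

instance : IsCofiltered PointIndex.{w} where
  cone_objs _ _ := ⟨.star, PUnit.unit, PUnit.unit, trivial⟩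
  cone_maps _ _ _ _ := ⟨.star, PUnit.unit, rfl⟩
  nonempty := ⟨.star⟩

/-- An object of `C`, viewed as a pro-object indexed by the category with one morphism. -/
def const (c : C) : ProObject.{w, w'} C where
  I := PointIndex.{w}
  diagram := (Functor.const _).obj c

end ProObject

/-! ### Homotopy categories of simplicial objects -/

/-- Two morphisms of a category over simplicial objects (via `F`) are related if there is a
simplicial homotopy between their images. -/
def homotopyRel {D : Type w} [Category.{w'} D] {C : Type u} [Category.{v} C]
    (F : D ⥤ SimplicialObject C) : HomRel D :=
  fun _ _ f g ↦ Nonempty (SimplicialObject.Homotopy (F.map f) (F.map g))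

/-- The category obtained from `D` by identifying morphisms whose images under `F` are
simplicially homotopic. -/
abbrev Ho {D : Type w} [Category.{w'} D] {C : Type u} [Category.{v} C]
    (F : D ⥤ SimplicialObject C) :=
  CategoryTheory.Quotient (homotopyRel F)

/-! ### The space of components -/

/-- The functor sending a space to its space of components, endowed with the quotient topology. -/
def piTop : TopCat.{u} ⥤ TopCat.{u} where
  obj X := TopCat.of (ConnectedComponents X)
  map f := TopCat.ofHom ⟨f.hom.continuous.connectedComponentsMap,
    f.hom.continuous.connectedComponentsMap_continuous⟩
  map_id X := by
    ext x
    obtain ⟨x, rfl⟩ := ConnectedComponents.surjective_coe x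
    rfl
  map_comp f g := by
    ext x
    obtain ⟨x, rfl⟩ := ConnectedComponents.surjective_coe x
    rfl

/-- The projection from a space to its space of components. -/
def toPi : 𝟭 TopCat.{u} ⟶ piTop.{u} where
  app X := TopCat.ofHom ⟨ConnectedComponents.mk, ConnectedComponents.continuous_coe⟩

/-- The map from the space of components of `X` induced by a map from `X` to a totally
disconnected space. -/
def piLift {X T : TopCat.{u}} [TotallyDisconnectedSpace T] (f : X ⟶ T) : piTop.obj X ⟶ T :=
  TopCat.ofHom ⟨f.hom.continuous.connectedComponentsLift,
    f.hom.continuous.connectedComponentsLift_continuous⟩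

lemma toPi_piLift {X T : TopCat.{u}} [TotallyDisconnectedSpace T] (f : X ⟶ T) :
    toPi.app X ≫ piLift f = f := rfl

/-- Simplicial spaces. -/
abbrev STop := SimplicialObject TopCat.{u}

/-- The space of simplicial components of a simplicial space: the coequaliser of
`X₁ ⇉ X₀` in the category of spaces. -/
def pi0Obj (X : STop.{u}) : TopCat.{u} :=
  coequalizer (X.δ (0 : Fin 2)) (X.δ (1 : Fin 2))

/-- The projection `X₀ ⟶ π₀(X)`. -/
def toPi0 (X : STop.{u}) : X _⦋0⦌ ⟶ pi0Obj X :=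
  coequalizer.π _ _

lemma toPi0_condition (X : STop.{u}) :
    X.δ (0 : Fin 2) ≫ toPi0 X = X.δ (1 : Fin 2) ≫ toPi0 X :=
  coequalizer.condition _ _

/-- The universal property of `π₀(X)`. -/
def pi0Lift {X : STop.{u}} {T : TopCat.{u}} (f : X _⦋0⦌ ⟶ T)
    (h : X.δ (0 : Fin 2) ≫ f = X.δ (1 : Fin 2) ≫ f) : pi0Obj X ⟶ T :=
  coequalizer.desc f h

lemma toPi0_pi0Lift {X : STop.{u}} {T : TopCat.{u}} (f : X _⦋0⦌ ⟶ T)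
    (h : X.δ (0 : Fin 2) ≫ f = X.δ (1 : Fin 2) ≫ f) : toPi0 X ≫ pi0Lift f h = f :=
  coequalizer.π_desc f h

lemma pi0_hom_ext {X : STop.{u}} {T : TopCat.{u}} {f g : pi0Obj X ⟶ T}
    (h : toPi0 X ≫ f = toPi0 X ≫ g) : f = g :=
  coequalizer.hom_ext h

lemma pi0Map_aux {X Y : STop.{u}} (f : X ⟶ Y) :
    X.δ (0 : Fin 2) ≫ f.app (op ⦋0⦌) ≫ toPi0 Y = X.δ (1 : Fin 2) ≫ f.app (op ⦋0⦌) ≫ toPi0 Y := by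
  rw [SimplicialObject.δ_naturality_assoc, SimplicialObject.δ_naturality_assoc, toPi0_condition]

/-- The functor `π₀` from simplicial spaces to spaces. -/
def pi0 : STop.{u} ⥤ TopCat.{u} where
  obj := pi0Obj
  map {X Y} f := pi0Lift (f.app (op ⦋0⦌) ≫ toPi0 Y) (pi0Map_aux f)
  map_id X := pi0_hom_ext (by
    rw [toPi0_pi0Lift]
    simp)
  map_comp f g := pi0_hom_ext (by
    rw [toPi0_pi0Lift, ← Category.assoc, toPi0_pi0Lift, Category.assoc, toPi0_pi0Lift]
    simp)

lemma toPi0_map {X Y : STop.{u}} (f : X ⟶ Y) :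
    toPi0 X ≫ pi0.map f = f.app (op ⦋0⦌) ≫ toPi0 Y :=
  toPi0_pi0Lift _ _

/-- `π₀` identifies homotopic morphisms. -/
lemma pi0_map_eq {X Y : STop.{u}} {f g : X ⟶ Y} (H : SimplicialObject.Homotopy f g) :
    pi0.map f = pi0.map g := by
  refine pi0_hom_ext ?_
  have h₀ : H.h (0 : Fin 1) ≫ Y.δ (0 : Fin 2) = g.app (op ⦋0⦌) := H.h_zero_comp_δ_zero 0
  have h₁ : H.h (0 : Fin 1) ≫ Y.δ (1 : Fin 2) = f.app (op ⦋0⦌) := H.h_last_comp_δ_last 0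
  rw [toPi0_map, toPi0_map, ← h₀, ← h₁, Category.assoc, Category.assoc, toPi0_condition]

/-! ### Pointed spaces and pointed simplicial spaces -/

/-- The one-point space. -/
abbrev pt : TopCat.{u} := TopCat.of PUnit.{u + 1}

/-- Pointed spaces. -/
abbrev PointedTop := Under pt.{u}

/-- The pointed space given by a point `x` of a space `X`. -/
def PointedTop.mk {X : TopCat.{u}} (x : X) : PointedTop.{u} :=
  Under.mk (TopCat.ofHom (ContinuousMap.const PUnit.{u + 1} x) : pt ⟶ X)

/-- The standard simplicial `0`-simplex, viewed as a simplicial space. -/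
abbrev sPt : STop.{u} := (SimplicialObject.const TopCat.{u}).obj pt

/-- Pointed simplicial spaces. -/
abbrev PointedSTop := Under sPt.{u}

/-- The space of components of a pointed space, pointed in the component of the base point. -/
def piPt : PointedTop.{u} ⥤ PointedTop.{u} :=
  Under.post piTop ⋙ Under.map (toPi.app pt)

/-- The space of simplicial components of a pointed simplicial space, pointed in the class of the
base point. -/
def pi0Pt : PointedSTop.{u} ⥤ PointedTop.{u} :=
  Under.post pi0 ⋙ Under.map (toPi0 sPt)

/-- The homotopy category of pointed simplicial spaces: morphisms respecting the base points,
up to (non-pointed) homotopy. -/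
abbrev HoPointedSTop := Ho (Under.forget sPt.{u})

/-- The functor induced by `π₀` on the homotopy category of pointed simplicial spaces. -/
def hoPi0Pt : HoPointedSTop.{u} ⥤ PointedTop.{u} :=
  CategoryTheory.Quotient.lift _ pi0Pt (by
    rintro X Y f g ⟨H⟩
    refine Under.UnderMorphism.ext ?_
    exact pi0_map_eq H)

/-! ### Coskeleta exist in categories with finite limits -/

section Coskeleta

instance finite_truncated (n : ℕ) : Finite (SimplexCategory.Truncated n) :=
  Finite.of_injective (fun a ↦ (⟨a.obj.len, Nat.lt_succ_of_le a.property⟩ : Fin (n + 1)))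
    (by
      intro a b h
      obtain ⟨a, ha⟩ := a
      obtain ⟨b, hb⟩ := b
      have h' : a.len = b.len := congrArg Fin.val h
      obtain rfl : a = b := SimplexCategory.ext h'
      rfl)

instance finite_structuredArrow (n : ℕ) (a : SimplexCategoryᵒᵖ) :
    Finite (StructuredArrow a (SimplexCategory.Truncated.inclusion n).op) := by
  have : Finite (SimplexCategory.Truncated n)ᵒᵖ :=
    Finite.of_injective Opposite.unop Opposite.unop_injective
  have (b : (SimplexCategory.Truncated n)ᵒᵖ) :
      Finite (a ⟶ (SimplexCategory.Truncated.inclusion n).op.obj b) :=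
    Finite.of_injective Quiver.Hom.unop Quiver.Hom.unop_inj
  refine Finite.of_injective
    (β := Σ b : (SimplexCategory.Truncated n)ᵒᵖ,
      (a ⟶ (SimplexCategory.Truncated.inclusion n).op.obj b)) (fun f ↦ ⟨f.right, f.hom⟩) ?_
  rintro ⟨⟨⟨⟩⟩, b, f⟩ ⟨⟨⟨⟩⟩, b', f'⟩ h
  obtain ⟨rfl, h⟩ := Sigma.mk.inj h
  obtain rfl := eq_of_heq h
  rfl

instance finCategory_structuredArrow (n : ℕ) (a : SimplexCategoryᵒᵖ) :
    FinCategory (StructuredArrow a (SimplexCategory.Truncated.inclusion n).op) where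
  fintypeObj := Fintype.ofFinite _
  fintypeHom f g := by
    have : Finite (f.right ⟶ g.right) :=
      Finite.of_injective
        (fun φ ↦ ((SimplexCategory.Truncated.inclusion n).op.map φ).unop)
        (fun φ ψ h ↦ (SimplexCategory.Truncated.inclusion n).op.map_injective
          (Quiver.Hom.unop_inj h))
    have : Finite (f ⟶ g) := Finite.of_injective (fun φ ↦ φ.right)
      (fun φ ψ h ↦ StructuredArrow.ext _ _ h)
    exact Fintype.ofFinite _

instance hasRightKanExtension {C : Type u} [Category.{v} C] [HasFiniteLimits C] (n : ℕ)
    (F : (SimplexCategory.Truncated n)ᵒᵖ ⥤ C) :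
    (SimplexCategory.Truncated.inclusion n).op.HasRightKanExtension F := by
  have : (SimplexCategory.Truncated.inclusion n).op.HasPointwiseRightKanExtension F := by
    intro a
    have := HasFiniteLimits.out (C := C)
      (StructuredArrow a (SimplexCategory.Truncated.inclusion n).op)
    dsimp only [Functor.HasPointwiseRightKanExtensionAt]
    infer_instance
  infer_instance

end Coskeleta

/-! ### Hypercoverings in the pro-étale site -/

section Hypercoverings

variable (S : Scheme.{u})

/-- A morphism `X ⟶ Y` in the pro-étale site of `S` is a covering if `{X ⟶ Y}` is a covering
family. -/
def IsCovering {S : Scheme.{u}} {X Y : S.ProEt} (f : X ⟶ Y) : Prop :=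
  Presieve.singleton f ∈ Scheme.ProEt.precoverage S Y

/-- The structure morphism `U ⟶ S` in the pro-étale site of `S`. -/
def toBase {S : Scheme.{u}} (U : S.ProEt) : U ⟶ Scheme.ProEt.mk (𝟙 S) :=
  MorphismProperty.Over.homMk U.hom (Category.comp_id _)

/-- A simplicial object `U` of the pro-étale site of `S` is a hypercovering if `U₀ ⟶ S` and
`U_{n+1} ⟶ cosk_n(U)_{n+1}`, for all `n`, are coverings. -/
structure IsHypercovering {S : Scheme.{u}} (U : SimplicialObject S.ProEt) : Prop where
  zero : IsCovering (toBase (U _⦋0⦌))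
  succ (n : ℕ) : IsCovering (((SimplicialObject.coskAdj n).unit.app U).app (op ⦋n + 1⦌))

/-- The category of hypercoverings of `S`. -/
abbrev Hy := ObjectProperty.FullSubcategory (IsHypercovering (S := S))

variable {S}
variable {Ω : Type u} [Field Ω] (s : Spec (.of Ω) ⟶ S)

/-- The functor on the pro-étale site of `S` sending `X` to its set of geometric points over the
geometric point `s` of `S`. -/
def fiber : S.ProEt ⥤ Type u :=
  Scheme.ProEt.forget S ⋙ coyoneda.obj (op (Over.mk s))

/-- The simplicial set of geometric points over `s` of a hypercovering. -/
def hyFiber : Hy S ⥤ SSet.{u} :=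
  ObjectProperty.ι _ ⋙ (SimplicialObject.whiskering S.ProEt (Type u)).obj (fiber s)

/-- The category of pointed hypercoverings of `(S, s)`: hypercoverings `U` together with a
morphism `Δ[0] ⟶ s(U)` of simplicial sets. -/
abbrev PointedHy := StructuredArrow (Δ[0] : SSet.{u}) (hyFiber s)

/-- The simplicial object of the pro-étale site underlying a pointed hypercovering. -/
abbrev PointedHy.toSimplicial : PointedHy s ⥤ SimplicialObject S.ProEt :=
  StructuredArrow.proj _ _ ⋙ ObjectProperty.ι _

/-- The homotopy category of pointed hypercoverings: morphisms respecting the base points, up to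
(non-pointed) homotopy. -/
abbrev HoPointedHy := Ho (PointedHy.toSimplicial s)

/-- The space of components of an object of the pro-étale site. -/
def proEtPi (S : Scheme.{u}) : S.ProEt ⥤ TopCat.{u} :=
  Scheme.ProEt.forget S ⋙ Over.forget S ⋙ Scheme.forgetToTop ⋙ piTop

/-- The simplicial space `π(U)` of a simplicial object `U` of the pro-étale site, given by taking
the space of components degreewise. -/
def simplicialPi (S : Scheme.{u}) : SimplicialObject S.ProEt ⥤ STop.{u} :=
  (SimplicialObject.whiskering _ _).obj (proEtPi S)

variable {s}

/-- The geometric point of `U_n` over `s` that corresponds to the image in `s(U_n)` of the unique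
`n`-simplex of `Δ[0]`. -/
def PointedHy.geomPt (U : PointedHy s) (n : SimplexCategoryᵒᵖ) :
    Spec (.of Ω) ⟶ (U.right.obj.obj n).left :=
  CommaMorphism.left (U.hom.app n (SSet.stdSimplex.objEquiv.symm (SimplexCategory.const _ _ 0)))

lemma PointedHy.geomPt_naturality (U : PointedHy s) {m n : SimplexCategoryᵒᵖ} (a : m ⟶ n) :
    U.geomPt m ≫ (U.right.obj.map a).left = U.geomPt n := by
  have h := NatTrans.naturality_apply U.hom a
    (SSet.stdSimplex.objEquiv.symm (SimplexCategory.const _ _ 0))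
  have h' : (Δ[0] : SSet.{u}).map a
      (SSet.stdSimplex.objEquiv.symm (SimplexCategory.const m.unop ⦋0⦌ 0)) =
      SSet.stdSimplex.objEquiv.symm (SimplexCategory.const n.unop ⦋0⦌ 0) :=
    SSet.stdSimplex.objEquiv.injective (Subsingleton.elim _ _)
  rw [h'] at h
  exact (congrArg CommaMorphism.left h).symm

lemma PointedHy.geomPt_map {U V : PointedHy s} (f : U ⟶ V) (n : SimplexCategoryᵒᵖ) :
    U.geomPt n ≫ (f.right.hom.app n).left = V.geomPt n := by
  have h : (U.hom ≫ (hyFiber s).map f.right).app n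
      (SSet.stdSimplex.objEquiv.symm (SimplexCategory.const _ _ 0)) =
      V.hom.app n (SSet.stdSimplex.objEquiv.symm (SimplexCategory.const _ _ 0)) := by
    rw [StructuredArrow.w f]
  exact congrArg CommaMorphism.left h

lemma PointedHy.geomPt_comp_hom (U : PointedHy s) (n : SimplexCategoryᵒᵖ) :
    U.geomPt n ≫ (U.right.obj.obj n).hom = s :=
  Over.w (U.hom.app n (SSet.stdSimplex.objEquiv.symm (SimplexCategory.const _ _ 0)))

/-- The point of the space of components of `U_n` given by the component of the geometric point
of `U_n`. -/
def PointedHy.basePt (U : PointedHy s) (n : SimplexCategoryᵒᵖ) :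
    (proEtPi S).obj (U.right.obj.obj n) :=
  ConnectedComponents.mk (U.geomPt n (default : Spec (.of Ω)))

/-- The functor sending a pointed hypercovering `(U, u)` to the pointed simplicial
space `π(U, u)`. -/
def pointedHyPi : PointedHy s ⥤ PointedSTop.{u} where
  obj U := Under.mk (Y := (simplicialPi S).obj U.right.obj)
    { app := fun n ↦ TopCat.ofHom (ContinuousMap.const _ (U.basePt n))
      naturality := by
        intro m n a
        ext x
        exact congrArg (fun φ : Spec (.of Ω) ⟶ (U.right.obj.obj n).left ↦
          ConnectedComponents.mk (φ (default : Spec (.of Ω)))) (U.geomPt_naturality a).symm }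
  map {U V} f := Under.homMk ((simplicialPi S).map f.right.hom) (by
    ext n x
    exact congrArg (fun φ : Spec (.of Ω) ⟶ (V.right.obj.obj n).left ↦
          ConnectedComponents.mk (φ (default : Spec (.of Ω)))) (PointedHy.geomPt_map f n))
  map_id U := by
    refine Under.UnderMorphism.ext ?_
    exact (simplicialPi S).map_id U.right.obj
  map_comp f g := by
    refine Under.UnderMorphism.ext ?_
    exact (simplicialPi S).map_comp f.right.hom g.right.hom

variable (s)

/-- The pointed pro-étale homotopy type of `(S, s)`, as a functor
`Ho(Hy(S, s)) ⥤ Ho(sTop_*)`. -/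
def proEtHomotopyType : HoPointedHy s ⥤ HoPointedSTop.{u} :=
  CategoryTheory.Quotient.lift _ (pointedHyPi ⋙ CategoryTheory.Quotient.functor _) (by
    rintro U V f g ⟨H⟩
    exact CategoryTheory.Quotient.sound _ ⟨H.whiskerRight (proEtPi S)⟩)

/-- The pointed space underlying a scheme `S` with a geometric point `s`. -/
def pointedSpace : PointedTop.{u} :=
  PointedTop.mk (X := Scheme.forgetToTop.obj S) (s (default : Spec (.of Ω)))

/-- The functor `Ho(Hy(S, s)) ⥤ Top_*` given by composing the pro-étale homotopy type with the
space of simplicial components and the space of components. -/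
def proEtComponents : HoPointedHy s ⥤ PointedTop.{u} :=
  proEtHomotopyType s ⋙ hoPi0Pt ⋙ piPt

variable {s}

lemma augmentation_aux (U : SimplicialObject S.ProEt) (i : Fin 2) :
    ((simplicialPi S).obj U).δ i ≫ piTop.map (Scheme.forgetToTop.map (U _⦋0⦌).hom) =
      piTop.map (Scheme.forgetToTop.map (U _⦋1⦌).hom) := by
  have h : Scheme.forgetToTop.map (U.δ i).left ≫ Scheme.forgetToTop.map (U _⦋0⦌).hom =
      Scheme.forgetToTop.map (U _⦋1⦌).hom := by
    rw [← Functor.map_comp]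
    exact congrArg _ (MorphismProperty.Over.w (U.δ i))
  exact ((piTop.map_comp _ _).symm.trans (congrArg piTop.map h))

/-- The map `π₀(π(U)) ⟶ π(S)` induced by `U₀ ⟶ S`. -/
def augmentationPi0 (U : SimplicialObject S.ProEt) :
    pi0.obj ((simplicialPi S).obj U) ⟶ piTop.obj (Scheme.forgetToTop.obj S) :=
  pi0Lift (piTop.map (Scheme.forgetToTop.map (U _⦋0⦌).hom)) (by
    rw [augmentation_aux, augmentation_aux])

instance totallyDisconnectedSpace_piTop (X : TopCat.{u}) :
    TotallyDisconnectedSpace (piTop.obj X) :=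
  inferInstanceAs (TotallyDisconnectedSpace (ConnectedComponents X))

/-- The map `π(π₀(π(U, u))) ⟶ π(S, s)` of pointed spaces induced by `U₀ ⟶ S`. -/
def augmentation (U : PointedHy s) :
    (proEtComponents s).obj ((CategoryTheory.Quotient.functor _).obj U) ⟶
      piPt.obj (pointedSpace s) :=
  Under.homMk (piLift (X := pi0.obj ((simplicialPi S).obj U.right.obj))
      (T := piTop.obj (Scheme.forgetToTop.obj S)) (augmentationPi0 U.right.obj)) (by
    ext x
    have h := congrArg (fun φ ↦ φ (U.basePt (op ⦋0⦌)))
      (toPi0_pi0Lift _ _ : toPi0 ((simplicialPi S).obj U.right.obj) ≫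
        augmentationPi0 U.right.obj =
          piTop.map (Scheme.forgetToTop.map (U.right.obj _⦋0⦌).hom))
    have h' : piTop.map (Scheme.forgetToTop.map (U.right.obj _⦋0⦌).hom) (U.basePt (op ⦋0⦌)) =
        ConnectedComponents.mk (s (default : Spec (.of Ω))) :=
      congrArg (fun φ : Spec (.of Ω) ⟶ S ↦
        ConnectedComponents.mk (φ (default : Spec (.of Ω)))) (U.geomPt_comp_hom (op ⦋0⦌))
    have h'' := congrArg (fun φ ↦ augmentationPi0 U.right.obj (φ x))
      (toPi0_map (pointedHyPi.obj U).hom)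
    exact h''.trans (h.trans h'))

/-- The pro-object `π ∘ π₀ ∘ Π(S, s)` of pointed spaces; it makes sense once `Ho(Hy(S, s))` is
known to be cofiltered. -/
def proComponents (s : Spec (.of Ω) ⟶ S) (h : IsCofiltered (HoPointedHy s)) :
    ProObject.{u + 1, u} PointedTop.{u} where
  I := HoPointedHy s
  diagram := proEtComponents s

/-! ### Morphisms of pointed schemes -/

variable {S' : Scheme.{u}} {s' : Spec (.of Ω) ⟶ S'}

/-- A morphism from a pointed hypercovering of `(S', s')` to a pointed hypercovering of `(S, s)`
lying over a morphism `f : S' ⟶ S`: a morphism of the underlying simplicial schemes compatible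
with `f` and with the base points. -/
structure PointedHy.HomOver (f : S' ⟶ S) (U' : PointedHy s') (U : PointedHy s) where
  app (n : SimplexCategoryᵒᵖ) : (U'.right.obj.obj n).left ⟶ (U.right.obj.obj n).left
  naturality {m n : SimplexCategoryᵒᵖ} (a : m ⟶ n) :
    (U'.right.obj.map a).left ≫ app n = app m ≫ (U.right.obj.map a).left
  w (n : SimplexCategoryᵒᵖ) : app n ≫ (U.right.obj.obj n).hom = (U'.right.obj.obj n).hom ≫ f
  point (n : SimplexCategoryᵒᵖ) : U'.geomPt n ≫ app n = U.geomPt n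

/-- The induced morphism `π(U', u') ⟶ π(U, u)` of pointed simplicial spaces. -/
def PointedHy.HomOver.pi {f : S' ⟶ S} {U' : PointedHy s'} {U : PointedHy s}
    (φ : PointedHy.HomOver f U' U) : pointedHyPi.obj U' ⟶ pointedHyPi.obj U :=
  Under.homMk (U := pointedHyPi.obj U') (V := pointedHyPi.obj U)
    ({ app := fun n ↦ piTop.map (Scheme.forgetToTop.map (φ.app n))
       naturality := by
        intro m n a
        have h : Scheme.forgetToTop.map (U'.right.obj.map a).left ≫
            Scheme.forgetToTop.map (φ.app n) =
            Scheme.forgetToTop.map (φ.app m) ≫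
              Scheme.forgetToTop.map (U.right.obj.map a).left := by
          rw [← Functor.map_comp, ← Functor.map_comp, φ.naturality]
        exact (piTop.map_comp _ _).symm.trans
          ((congrArg piTop.map h).trans (piTop.map_comp _ _)) } :
      (simplicialPi S').obj U'.right.obj ⟶ (simplicialPi S).obj U.right.obj)
    (by
      ext n x
      exact congrArg (fun ψ : Spec (.of Ω) ⟶ (U.right.obj.obj n).left ↦
          ConnectedComponents.mk (ψ (default : Spec (.of Ω)))) (φ.point n))

/-- The map `π(π₀(π(U', u'))) ⟶ π(π₀(π(U, u)))` of pointed spaces induced by a morphism of pointed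
hypercoverings over `f`. -/
def PointedHy.HomOver.components {f : S' ⟶ S} {U' : PointedHy s'} {U : PointedHy s}
    (φ : PointedHy.HomOver f U' U) :
    (proEtComponents s').obj ((CategoryTheory.Quotient.functor _).obj U') ⟶
      (proEtComponents s).obj ((CategoryTheory.Quotient.functor _).obj U) :=
  (pi0Pt ⋙ piPt).map φ.pi

/-- The map of pointed spaces underlying a morphism of pointed schemes. -/
def pointedSpaceMap (f : S' ⟶ S) (hf : s' ≫ f = s) : pointedSpace s' ⟶ pointedSpace s :=
  Under.homMk (U := pointedSpace s') (V := pointedSpace s) (Scheme.forgetToTop.map f) (by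
    ext x
    exact congrArg (fun ψ : Spec (.of Ω) ⟶ S ↦ ψ (default : Spec (.of Ω))) hf)

end Hypercoverings

end ProEtaleHomotopy

end

/-!
# Connected components and the pro-étale homotopy type

*Hypercoverings as fibrant objects.* A simplicial object `U` of the pro-étale site of `S` is viewed
as the presheaf of simplicial sets `T ↦ Hom_S(T, U)` on all schemes over `S`. A map `K ⟶ L` of
simplicial sets is called *fillable* for such a presheaf `A` if the restriction
`Hom(L, A(-)) ⟶ Hom(K, A(-))` is represented by coverings, that is, if maps `K ⟶ A` extend to `L`
locally. Since `Hom(∂Δ[n + 1], U)` is represented by `cosk_n(U)_{n+1}`, the simplicial object `U` is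
a hypercovering if and only if all the inclusions `∂Δ[n] ⟶ Δ[n]` are fillable for it
(`isHypercovering_iff`). As fillable maps are stable under composition and cobase change, every
monomorphism into a finite simplicial set is then fillable (`fillable_of_mono`), by attaching the
nondegenerate simplices one after the other.

*Cofilteredness.* For hypercoverings `U`, `V`, a finite simplicial set `L` with a subcomplex `K` and
a map `U ⟶ V ^ K`, the pullback of `V ^ L ⟶ V ^ K` to `U` is again a hypercovering
(`exists_hypercovering_isPullback`): it is levelwise representable by coverings of `U`, and maps
into it extend along `∂Δ[n] ⟶ Δ[n]` because maps into `V` extend along the inclusion of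
`(L ⊗ ∂Δ[n]) ∪ (K ⊗ Δ[n])` into `L ⊗ Δ[n]`. For `K = ∅` and `L = Δ[0]` it is a product, which
dominates both `U` and `V`; for `K = ∂Δ[1]`, `L = Δ[1]` and a pair of morphisms `f`, `g` from `U` to
`V` it is the object of paths from `f` to `g`, on which `f` and `g` become homotopic. The fibre at
the geometric point `s` is the value of the presheaf at `s`, so base points are obtained by evaluating
the pullback squares at `s`; on path objects they are the constant paths.

*Components.* The augmentation `π(π₀(π(U))) ⟶ π(S)` is already an isomorphism for every
hypercovering `U` (`isIso_piLift_augmentationPi0`). Continuous maps to a fixed space form a sheaf for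
the fpqc topology, and two points of `U₀` over the same point of `S` come, locally, from a point of
`U₁` (`exists_covering_lift`). Hence `S` is the coequaliser of `U₁ ⇉ U₀` as a space
(`exists_continuousMap_desc`). Both sides of the augmentation therefore corepresent the same functor
on totally disconnected spaces. The augmentations are compatible with all morphisms, so that over the
cofiltered index category they define a single morphism of pro-objects, and their inverses define the
inverse morphism.
-/

noncomputable section

namespace ProEtaleHomotopy

/-! ### Simplicial sets: attaching cells and maps out of low-dimensional simplicial sets -/

section Cells

open SSet

variable {Y : SSet.{u}}

/-- Attaching one cell: if `x` is a nondegenerate simplex of `Y` outside a subcomplex `A` which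
contains all the proper faces of `x`, then `A ⊔ ⟨x⟩` is obtained from `A` by attaching a simplex
along its boundary. -/
lemma isPushout_attach (A : Y.Subcomplex) {d : ℕ} (x : Y _⦋d⦌) (hx : x ∈ Y.nonDegenerate d)
    (hA : A.preimage (yonedaEquiv.symm x) = ∂Δ[d]) :
    IsPushout
      (Subcomplex.lift (∂Δ[d].ι ≫ yonedaEquiv.symm x) (by
        rw [Subcomplex.range_comp, Subcomplex.image_le_iff, hA]; simp) : (∂Δ[d] : SSet) ⟶ A)
      ∂Δ[d].ι
      (Subcomplex.homOfLE le_sup_left : (A : SSet) ⟶ (A ⊔ Subcomplex.ofSimplex x : Y.Subcomplex))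
      (Subcomplex.lift (yonedaEquiv.symm x) (by
        rw [Subcomplex.range_eq_ofSimplex]; simp)) := by
  have key (m : SimplexCategoryᵒᵖ) (y : (Δ[d] : SSet.{u}).obj m) :
      (yonedaEquiv.symm x).app m y ∈ A.obj m ↔ y ∈ (∂Δ[d] : Subcomplex _).obj m := by
    rw [← hA]; rfl
  refine ⟨⟨rfl⟩, ⟨evaluationJointlyReflectsColimits _ (fun m ↦
    (isColimitMapCoconePushoutCoconeEquiv _ _).2 (IsPushout.isColimit ?_))⟩⟩
  refine Types.isPushout_of_isPullback_of_mono' ?_ ?_ ?_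
  · rw [Types.isPullback_iff]
    refine ⟨rfl, fun a b h ↦ Subtype.ext h.2, fun a b h ↦ ?_⟩
    have h' : a.1 = (yonedaEquiv.symm x).app m b := congrArg Subtype.val h
    exact ⟨⟨b, (key m b).1 (h' ▸ a.2)⟩, Subtype.ext h'.symm, rfl⟩
  · refine Set.eq_univ_of_forall ?_
    rintro ⟨z, hz | ⟨f, hf⟩⟩
    · exact Or.inl ⟨⟨z, hz⟩, rfl⟩
    · exact Or.inr ⟨stdSimplex.objEquiv.symm f.unop, Subtype.ext hf⟩
  · intro a b ha hb h
    have aux (c : (Δ[d] : SSet.{u}).obj m) (hc : c ∉ Set.range ((∂Δ[d] : Subcomplex _).ι.app m)) :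
        ∃ (f : m.unop ⟶ ⦋d⦌) (_ : Epi f), c = stdSimplex.objEquiv.symm f := by
      have hc' : c ∉ (∂Δ[d] : Subcomplex _).obj m := fun h ↦ hc ⟨⟨c, h⟩, rfl⟩
      refine ⟨stdSimplex.objEquiv c, ?_, by simp⟩
      simpa [SimplexCategory.epi_iff_surjective, boundary] using! hc'
    obtain ⟨f, _, rfl⟩ := aux a ha
    obtain ⟨g, _, rfl⟩ := aux b hb
    have h' : Y.map f.op x = Y.map g.op x := congrArg Subtype.val h
    obtain rfl : f = g := Y.unique_nonDegenerate_map _ f ⟨x, hx⟩ rfl g ⟨x, hx⟩ h'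
    rfl

/-- The case of the inclusion of a subcomplex `A`, by induction on the number of nondegenerate
simplices outside `A`. -/
lemma property_subcomplex_ι_of_boundary (W : MorphismProperty SSet.{u})
    [W.IsMultiplicative] [W.RespectsIso]
    [W.IsStableUnderCobaseChange] (hW : ∀ n, W (∂Δ[n] : Subcomplex.{u} _).ι) [Y.Finite]
    (A : Y.Subcomplex) : W A.ι := by
  induction h : (Set.ofPred fun x : Y.N ↦ x.simplex ∉ A.obj _).ncard using Nat.strong_induction_on
    generalizing A with
  | _ k IH =>
    by_cases hA : A = ⊤
    · subst hA
      exact W.of_isIso (Subcomplex.topIso Y).hom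
    · have hex : ∃ (d : ℕ) (x : Y _⦋d⦌), x ∈ Y.nonDegenerate d ∧ x ∉ A.obj _ := by
        by_contra! hcon
        exact hA ((Subcomplex.eq_top_iff_contains_nonDegenerate A).2 fun n x hx ↦ hcon n x hx)
      -- A simplex of minimal dimension outside `A` has all its proper faces in `A`.
      classical
      obtain ⟨x, hx, hxA⟩ := Nat.find_spec hex
      have hmin : ∀ m < Nat.find hex, ∀ y ∈ Y.nonDegenerate m, y ∈ A.obj _ := by
        intro m hm y hy
        by_contra hyA
        exact Nat.find_min hex hm ⟨y, hy, hyA⟩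
      generalize Nat.find hex = d at *
      have hpre : A.preimage (yonedaEquiv.symm x) = ∂Δ[d] := by
        rw [stdSimplex.eq_boundary_iff]
        refine ⟨?_, fun h ↦ hxA ?_⟩
        · rw [Subcomplex.le_iff_contains_nonDegenerate]
          rintro n ⟨y, hy₁⟩ hy₂
          have hn : n < d := dim_lt_of_nonDegenerate (X := ∂Δ[d])
            ⟨⟨y, hy₂⟩, (Subcomplex.mem_nonDegenerate_iff _ _).2 hy₁⟩ d
          obtain ⟨i, f, _, z, hz⟩ := Y.exists_nonDegenerate ((yonedaEquiv.symm x).app _ y)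
          change (yonedaEquiv.symm x).app _ y ∈ A.obj _
          rw [hz]
          have := SimplexCategory.len_le_of_epi f
          exact A.map f.op (hmin i (lt_of_le_of_lt this hn) _ z.2)
        · have := h.symm.le _ (show stdSimplex.objEquiv.symm (𝟙 ⦋d⦌) ∈ _ by simp)
          simpa using! this
      have hp := isPushout_attach A x hx hpre
      have h₁ := W.of_isPushout hp (hW d)
      have h₂ : W (A ⊔ Subcomplex.ofSimplex x : Y.Subcomplex).ι := by
        refine IH _ ?_ _ rfl
        rw [← h]
        refine Set.ncard_lt_ncard ⟨fun y hy hyA ↦ hy (Or.inl hyA), fun hle ↦ ?_⟩ (Set.toFinite _)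
        exact hle (a := N.mk x hx) hxA (Or.inr (Subcomplex.mem_ofSimplex_obj x))
      exact W.comp_mem _ _ h₁ h₂

/-- A class of morphisms of simplicial sets which is closed under composition and cobase change
contains every monomorphism into a finite simplicial set as soon as it contains the inclusions
`∂Δ[n] ⟶ Δ[n]`. -/
lemma property_of_mono_of_boundary (W : MorphismProperty SSet.{u})
    [W.IsMultiplicative] [W.RespectsIso]
    [W.IsStableUnderCobaseChange] (hW : ∀ n, W (∂Δ[n] : Subcomplex.{u} _).ι) {X : SSet.{u}}
    [Y.Finite] (i : X ⟶ Y) [Mono i] : W i := by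
  rw [← Subcomplex.toRange_ι i]
  exact W.comp_mem _ _ (W.of_isIso _) (property_subcomplex_ι_of_boundary W hW _)

/-- A morphism of simplicial sets that is bijective in degrees `< d` induces a bijection on
morphisms from any nonsingular simplicial set of dimension `< d`. -/
lemma bijective_comp_of_hasDimensionLT {X X' : SSet.{u}} (f : X ⟶ X') (d : ℕ)
    (hf : ∀ m < d, Function.Bijective (f.app (op ⦋m⦌))) (K : SSet.{u}) [K.Nonsingular]
    [K.HasDimensionLT d] : Function.Bijective (fun g : K ⟶ X ↦ g ≫ f) := by
  -- A nonsingular simplicial set is the colimit of its nondegenerate simplices.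
  rw [← MorphismProperty.isColocal_single_iff_bijective]
  refine ObjectProperty.prop_of_isColimit _ K.isColimitCoconeN' fun x ↦ ?_
  rw [MorphismProperty.isColocal_single_iff_bijective]
  have hx : x.dim < d := K.dim_lt_of_nonDegenerate ⟨_, x.nonDegenerate⟩ d
  have h := hf _ hx
  rw [← Function.Bijective.of_comp_iff' (SSet.yonedaEquiv (X := X')).symm.bijective,
    ← Function.Bijective.of_comp_iff _ (SSet.yonedaEquiv (X := X)).bijective] at h
  refine (congrArg Function.Bijective (funext fun g ↦ ?_)).mp h
  exact SSet.yonedaEquiv.symm_apply_eq.2 rfl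

end Cells

/-! ### Local extension of maps into a presheaf of simplicial sets -/

section Fillers

open MonoidalCategory

variable {C : Type w} [Category.{u} C]

/-- For a presheaf `A` of simplicial sets, the functor that sends a simplicial set `K` to the
presheaf of sets `T ↦ Hom(K, A(T))`. -/
def mapsInto (A : Cᵒᵖ ⥤ SSet.{u}) : SSet.{u}ᵒᵖ ⥤ Cᵒᵖ ⥤ Type u :=
  coyoneda ⋙ (Functor.whiskeringLeft _ _ _).obj A

/-- The morphisms `K ⟶ L` of simplicial sets along which maps into `A` extend locally for the
covering notion `P`: the restriction `Hom(L, A(-)) ⟶ Hom(K, A(-))` is relatively representable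
and belongs to `P`. -/
def fillable (P : MorphismProperty C) (A : Cᵒᵖ ⥤ SSet.{u}) : MorphismProperty SSet.{u} :=
  (P.presheaf.inverseImage (mapsInto A)).unop

variable (P : MorphismProperty C) (A B W : Cᵒᵖ ⥤ SSet.{u})

lemma fillable_iff {K L : SSet.{u}} (i : K ⟶ L) :
    fillable P A i ↔ P.presheaf ((mapsInto A).map i.op) := Iff.rfl

instance [P.IsMultiplicative] [P.RespectsIso] : (fillable P A).IsMultiplicative :=
  inferInstanceAs (P.presheaf.inverseImage (mapsInto A)).unop.IsMultiplicative

instance : (fillable P A).RespectsIso :=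
  inferInstanceAs (P.presheaf.inverseImage (mapsInto A)).unop.RespectsIso

/-- `Hom(-, A)` turns pushouts into pullbacks; hence fillable maps are stable under cobase
change. -/
lemma isPullback_mapsInto {K₁ K₂ K₃ K₄ : SSet.{u}} {t : K₁ ⟶ K₂} {l : K₁ ⟶ K₃} {r : K₂ ⟶ K₄}
    {b : K₃ ⟶ K₄} (sq : IsPushout t l r b) :
    IsPullback ((mapsInto A).map r.op) ((mapsInto A).map b.op) ((mapsInto A).map t.op)
      ((mapsInto A).map l.op) :=
  IsPullback.of_forall_isPullback_app fun T ↦ sq.op.flip.map (yoneda.obj (A.obj T))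

instance : (fillable P A).IsStableUnderCobaseChange where
  of_isPushout sq h := by
    have := P.relative_isStableUnderBaseChange (F := yoneda)
    exact P.presheaf.of_isPullback (isPullback_mapsInto A sq).flip h

variable {P A}

/-- If maps into `A` extend locally from the boundaries of simplices, then they extend locally along
every monomorphism into a finite simplicial set. -/
lemma fillable_of_mono [P.IsMultiplicative] [P.RespectsIso]
    (hA : ∀ n, fillable P A (∂Δ[n] : SSet.Subcomplex.{u} _).ι)
    {K L : SSet.{u}} [L.Finite] (i : K ⟶ L) [Mono i] : fillable P A i :=
  property_of_mono_of_boundary _ hA i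

variable {B W}

/-- Maps into `B ⋙ ihom L` are maps from a product with `L` into `B`. -/
def uncurryMaps {L : SSet.{u}} (q : W ⟶ B ⋙ ihom L) (M : SSet.{u}) :
    (mapsInto W).obj (op M) ⟶ (mapsInto B).obj (op (L ⊗ M)) where
  app T := ↾fun f : M ⟶ W.obj T ↦ (MonoidalClosed.uncurry (f ≫ q.app T) : L ⊗ M ⟶ B.obj T)
  naturality T T' a := by
    ext (f : M ⟶ W.obj T)
    change MonoidalClosed.uncurry ((f ≫ W.map a) ≫ q.app T') =
      MonoidalClosed.uncurry (f ≫ q.app T) ≫ B.map a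
    rw [← MonoidalClosed.uncurry_natural_right, Category.assoc, q.naturality, Category.assoc]
    rfl

lemma uncurryMaps_naturality {L M N : SSet.{u}} (q : W ⟶ B ⋙ ihom L) (j : M ⟶ N) :
    (mapsInto W).map j.op ≫ uncurryMaps q M = uncurryMaps q N ≫ (mapsInto B).map (L ◁ j).op := by
  ext T (f : N ⟶ W.obj T)
  change MonoidalClosed.uncurry ((j ≫ f) ≫ q.app T) =
    L ◁ j ≫ MonoidalClosed.uncurry (f ≫ q.app T)
  rw [← MonoidalClosed.uncurry_natural_left, Category.assoc]

section

variable {K L : SSet.{u}} {i : K ⟶ L} {φ : A ⟶ B ⋙ ihom K} {p : W ⟶ A} {q : W ⟶ B ⋙ ihom L}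

variable (sq : IsPullback p q φ (Functor.whiskerLeft B (MonoidalClosed.pre i)))

include sq

/-- If `W` is the pullback of `A ⟶ B ^ K` along `B ^ L ⟶ B ^ K`, then maps `M ⟶ W` are
pairs of a map `M ⟶ A` and a map `L ⊗ M ⟶ B` which agree on `K ⊗ M`. -/
lemma isPullback_uncurryMaps (M : SSet.{u}) :
    IsPullback ((Functor.whiskerRight p (coyoneda.obj (op M)) :
        (mapsInto W).obj (op M) ⟶ (mapsInto A).obj (op M)))
      (uncurryMaps q M) (uncurryMaps φ M) ((mapsInto B).map (i ▷ M).op) := by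
  refine IsPullback.of_forall_isPullback_app fun T ↦ ?_
  have sqT := (sq.map ((evaluation _ _).obj T)).map (coyoneda.obj (op M))
  refine sqT.of_iso (Iso.refl _) (Iso.refl _)
    ((ihom.adjunction L).homEquiv M (B.obj T)).symm.toIso
    ((ihom.adjunction K).homEquiv M (B.obj T)).symm.toIso rfl rfl rfl ?_
  refine ConcreteCategory.hom_ext _ _ fun (f : M ⟶ (ihom L).obj (B.obj T)) ↦ ?_
  exact MonoidalClosed.uncurry_pre_app _ f i

end

/-- The relative path object lemma: let `W` be the pullback of `A ⟶ B ^ S` along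
`B ^ L ⟶ B ^ S`. If maps into `A` extend along `T ⟶ Y`, and maps into `B` extend along
`(L ⊗ T) ∪ (S ⊗ Y) ⟶ L ⊗ Y`, then maps into `W` extend along `T ⟶ Y`. -/
lemma fillable_of_isPullback [P.IsMultiplicative] {L Y : SSet.{u}} (S : L.Subcomplex)
    (T : Y.Subcomplex) {φ : A ⟶ B ⋙ ihom (S : SSet.{u})} {p : W ⟶ A} {q : W ⟶ B ⋙ ihom L}
    (sq : IsPullback p q φ (Functor.whiskerLeft B (MonoidalClosed.pre S.ι)))
    (hA : fillable P A T.ι) (hB : fillable P B (S.unionProd T).ι) : fillable P W T.ι := by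
  have := P.relative_isStableUnderBaseChange (F := yoneda)
  let pM (M : SSet.{u}) : (mapsInto W).obj (op M) ⟶ (mapsInto A).obj (op M) :=
    Functor.whiskerRight p (coyoneda.obj (op M))
  have hT : IsPullback (pM T) (uncurryMaps q T) (uncurryMaps φ T)
    ((mapsInto B).map (S.ι ▷ (T : SSet)).op) := isPullback_uncurryMaps sq T
  have hY : IsPullback (pM Y) (uncurryMaps q Y) (uncurryMaps φ Y)
    ((mapsInto B).map (S.ι ▷ Y).op) := isPullback_uncurryMaps sq Y
  have hU := isPullback_mapsInto B (SSet.Subcomplex.unionProd.isPushout S T)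
  have hQ := IsPullback.of_hasPullback ((mapsInto A).map T.ι.op) (pM T)
  -- `Q = Hom(Y, A) ×_{Hom(T, A)} Hom(T, W)` identifies to the fibre product of `Hom(Y, A)` and
  -- `Hom((L ⊗ T) ∪ (S ⊗ Y), B)` over `Hom(S ⊗ Y, B)`.
  have hQ' := hQ.paste_vert hT
  rw [uncurryMaps_naturality] at hQ'
  have hQU := hQ'.of_bot' hU.flip
  have hY' := hY
  rw [← SSet.Subcomplex.unionProd.ι₂_ι S T, op_comp, Functor.map_comp] at hY'
  have hl := hY'.of_right' hQU
  have h₁ := P.presheaf.of_isPullback hl.flip hB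
  have h₂ := P.presheaf.of_isPullback hQ hA
  have h₃ := P.presheaf.comp_mem _ _ h₁ h₂
  rw [fillable_iff]
  convert h₃ using 1
  have hl₁ := hl.w
  refine hT.hom_ext ?_ ?_
  · rw [Category.assoc, ← hQ.w, IsPullback.lift_fst_assoc]
    rfl
  · rw [uncurryMaps_naturality, Category.assoc, ← SSet.Subcomplex.unionProd.ι₁_ι S T, op_comp,
      Functor.map_comp, ← reassoc_of% hl₁, IsPullback.lift_snd]

end Fillers

/-! ### Coskeleta and matching conditions -/

section Coskeletal

/-- A right Kan extension from simplices of dimension `≤ n` does not distinguish simplicial sets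
which agree in dimension `≤ n`. -/
lemma bijective_comp_of_isRightKanExtension (n : ℕ) (X : SSet.{u})
    {F : (SimplexCategory.Truncated n)ᵒᵖ ⥤ Type u}
    (α : (SimplexCategory.Truncated.inclusion n).op ⋙ X ⟶ F)
    [hX : Functor.IsRightKanExtension X α]
    {K K' : SSet.{u}} (j : K ⟶ K') (hj : ∀ m ≤ n, Function.Bijective (j.app (op ⦋m⦌))) :
    Function.Bijective (fun f : K' ⟶ X ↦ j ≫ f) := by
  let L := (SimplexCategory.Truncated.inclusion n).op
  have : IsIso (Functor.whiskerLeft L j) := by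
    have h₀ (a : (SimplexCategory.Truncated n)ᵒᵖ) : IsIso ((Functor.whiskerLeft L j).app a) := by
      rw [isIso_iff_bijective]
      exact hj _ a.unop.property
    exact NatIso.isIso_of_isIso_app _
  rw [← Function.Bijective.of_comp_iff'
    (Functor.homEquivOfIsRightKanExtension X α K).bijective]
  have h : Function.Bijective (fun f : L ⋙ K' ⟶ F ↦ Functor.whiskerLeft L j ≫ f) :=
    ((asIso (Functor.whiskerLeft L j)).homFromEquiv (Z := F)).symm.bijective
  have h' := h.comp (Functor.homEquivOfIsRightKanExtension X α K').bijective
  convert h' using 1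
  funext f
  rfl

variable {D : Type w} [Category.{u} D] [HasFiniteLimits D]

instance hasPointwiseRightKanExtension (n : ℕ) (F : (SimplexCategory.Truncated n)ᵒᵖ ⥤ D) :
    (SimplexCategory.Truncated.inclusion n).op.HasPointwiseRightKanExtension F := by
  intro a
  have := HasFiniteLimits.out (C := D)
    (StructuredArrow a (SimplexCategory.Truncated.inclusion n).op)
  dsimp only [Functor.HasPointwiseRightKanExtensionAt]
  infer_instance

/-- Coskeleta are computed by finite limits, and hence preserved by left exact functors. -/
lemma isRightKanExtension_cosk_comp (n : ℕ) (F : (SimplexCategory.Truncated n)ᵒᵖ ⥤ D)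
    (G : D ⥤ Type u) [PreservesFiniteLimits G] :
    Functor.IsRightKanExtension ((SimplicialObject.Truncated.cosk n).obj F ⋙ G)
      ((Functor.associator _ _ _).inv ≫ Functor.whiskerRight
        ((SimplexCategory.Truncated.inclusion n).op.ranCounit.app F) G) := by
  let L := (SimplexCategory.Truncated.inclusion n).op
  have h : ((Functor.RightExtension.postcompose₂ L F G).obj
      (Functor.RightExtension.mk _ (L.ranCounit.app F))).IsPointwiseRightKanExtension := by
    intro a
    have := PreservesFiniteLimits.preservesFiniteLimits (F := G) (StructuredArrow a L)
    exact IsLimit.ofIsoLimit (isLimitOfPreserves G (L.isPointwiseRightKanExtensionRanCounit F a))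
      (Functor.RightExtension.coneAtWhiskerRightIso G F L _ a).symm
  exact ((Functor.RightExtension.isPointwiseRightKanExtensionEquivOfIso
    (Functor.RightExtension.postcompose₂ObjMkIso G _)) h).isRightKanExtension

/-- The unit `U ⟶ cosk_n(U)` is an isomorphism in degrees `≤ n`. -/
lemma isIso_coskAdj_unit_app (n : ℕ) (U : SimplicialObject D) (m : ℕ) (hm : m ≤ n) :
    IsIso (((SimplicialObject.coskAdj n).unit.app U).app (op ⦋m⦌)) := by
  let L := (SimplexCategory.Truncated.inclusion n).op
  have h := Functor.ranCounit_app_app_ranAdjunction_unit_app_app (L := L) U (op ⟨⦋m⦌, hm⟩)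
  have : IsIso (((L.ranAdjunction D).unit.app U).app (L.obj (op ⟨⦋m⦌, hm⟩)) ≫
      (L.ranCounit.app (L ⋙ U)).app (op ⟨⦋m⦌, hm⟩)) := by
    rw [h]
    infer_instance
  exact IsIso.of_isIso_comp_right (((L.ranAdjunction D).unit.app U).app (L.obj (op ⟨⦋m⦌, hm⟩)))
    ((L.ranCounit.app (L ⋙ U)).app (op ⟨⦋m⦌, hm⟩))

end Coskeletal

section Represented

variable {C : Type w} [Category.{u} C] {D : Type w'} [Category.{u} D]

/-- A simplicial object `U` of `D`, viewed through a functor `ι : D ⥤ C` as the presheaf of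
simplicial sets `T ↦ Hom(T, ι(U))` on `C`. -/
def represented (ι : D ⥤ C) : SimplicialObject D ⥤ Cᵒᵖ ⥤ SSet.{u} :=
  (SimplicialObject.whiskering D (Cᵒᵖ ⥤ Type u)).obj (ι ⋙ yoneda) ⋙ flipFunctor _ _ _

/-- Maps from the standard simplex `Δ[n]` into `A` are the `n`-simplices of `A`. -/
def mapsIntoStdSimplexIso (A : Cᵒᵖ ⥤ SSet.{u}) (n : ℕ) :
    (mapsInto A).obj (op Δ[n]) ≅ A ⋙ (evaluation _ _).obj (op ⦋n⦌) :=
  NatIso.ofComponents (fun T ↦ (SSet.yonedaEquiv (X := A.obj T)).toIso) (fun _ ↦ rfl)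

/-- Maps from `Δ[n]` into `Hom(-, U)` are represented by `U_n`. -/
def mapsIntoRepresentedIso (ι : D ⥤ C) (U : SimplicialObject D) (n : ℕ) :
    (mapsInto ((represented ι).obj U)).obj (op Δ[n]) ≅ yoneda.obj (ι.obj (U _⦋n⦌)) :=
  mapsIntoStdSimplexIso _ n

variable (P : MorphismProperty C)

/-- The `(n + 1)`-st matching map `U_{n+1} ⟶ cosk_n(U)_{n+1}` represents the restriction of maps
into `U` from `Δ[n + 1]` to `∂Δ[n + 1]`. -/
lemma covering_cosk_iff [HasPullbacks C] [P.IsStableUnderBaseChange] [HasFiniteLimits D]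
    (ι : D ⥤ C) [PreservesFiniteLimits ι] (U : SimplicialObject D) (n : ℕ) :
    P (ι.map (((SimplicialObject.coskAdj n).unit.app U).app (op ⦋n + 1⦌))) ↔
      fillable P ((represented ι).obj U) (∂Δ[n + 1] : SSet.Subcomplex.{u} _).ι := by
  let V := (SimplicialObject.cosk n).obj U
  let f := (represented ι).map ((SimplicialObject.coskAdj n).unit.app U)
  let F (K : SSet.{u}) : (mapsInto ((represented ι).obj U)).obj (op K) ⟶
    (mapsInto ((represented ι).obj V)).obj (op K) := Functor.whiskerRight f (coyoneda.obj (op K))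
  -- The boundary has dimension `≤ n`, and `U` agrees with its coskeleton in these degrees.
  have hF₁ : IsIso (F ∂Δ[n + 1]) := by
    have h₀ (T : Cᵒᵖ) : IsIso ((F ∂Δ[n + 1]).app T) := by
      rw [isIso_iff_bijective]
      refine bijective_comp_of_hasDimensionLT (f.app T) (n + 1) (fun m hm ↦ ?_) _
      rw [← isIso_iff_bijective]
      have := isIso_coskAdj_unit_app n U m (by lia)
      exact inferInstanceAs (IsIso ((ι ⋙ coyoneda.obj T).map _))
    exact NatIso.isIso_of_isIso_app _
  -- Maps into a coskeleton do not see the difference between `∂Δ[n + 1]` and `Δ[n + 1]`.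
  have hF₂ : IsIso ((mapsInto ((represented ι).obj V)).map
      (∂Δ[n + 1] : SSet.Subcomplex _).ι.op) := by
    have h₀ (T : Cᵒᵖ) : IsIso (((mapsInto ((represented ι).obj V)).map
        (∂Δ[n + 1] : SSet.Subcomplex _).ι.op).app T) := by
      rw [isIso_iff_bijective]
      have hV := isRightKanExtension_cosk_comp n ((SimplicialObject.truncation n).obj U)
        (ι ⋙ coyoneda.obj T)
      refine bijective_comp_of_isRightKanExtension (X := ((represented ι).obj V).obj T) (hX := hV)
        n _ _ fun m hm ↦ ⟨Subtype.val_injective, fun x ↦ ⟨⟨x, ?_⟩, rfl⟩⟩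
      rw [SSet.boundary_obj_eq_univ m (n + 1)]
      trivial
    exact NatIso.isIso_of_isIso_app _
  have w : (mapsInto ((represented ι).obj U)).map (∂Δ[n + 1] : SSet.Subcomplex _).ι.op ≫
      F ∂Δ[n + 1] = F Δ[n + 1] ≫ (mapsInto ((represented ι).obj V)).map
        (∂Δ[n + 1] : SSet.Subcomplex _).ι.op := rfl
  rw [fillable_iff, ← P.presheaf.cancel_right_of_respectsIso _ (F ∂Δ[n + 1]), w,
    P.presheaf.cancel_right_of_respectsIso, ← P.relative_map_iff (F := yoneda)]
  refine (P.presheaf.arrow_mk_iso_iff (Arrow.isoMk (f := Arrow.mk (F Δ[n + 1]))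
    (g := Arrow.mk (yoneda.map (ι.map (((SimplicialObject.coskAdj n).unit.app U).app
      (op ⦋n + 1⦌))))) (mapsIntoRepresentedIso ι U (n + 1))
    (mapsIntoRepresentedIso ι V (n + 1)) ?_)).symm
  rfl

end Represented

/-! ### Hypercoverings and local extension of maps -/

section Coverings

/-- The morphisms which form a covering family on their own. -/
def singletonCoverings {E : Type w} [Category.{v} E] (J : Precoverage E) : MorphismProperty E :=
  fun _ Y f ↦ Presieve.singleton f ∈ J Y

section

variable {E : Type w} [Category.{v} E] (J : Precoverage E)

instance [J.IsStableUnderBaseChange] : (singletonCoverings J).IsStableUnderBaseChange where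
  of_isPullback {X Y Y' S f g f' g'} sq h := by
    have h' : Presieve.ofArrows (fun _ : PUnit.{1} ↦ Y) (fun _ ↦ g) ∈ J S := by
      rw [Presieve.ofArrows_pUnit]
      exact h
    have := J.mem_coverings_of_isPullback _ h' f (fun _ ↦ g') (fun _ ↦ f') (fun _ ↦ sq.flip)
    rwa [Presieve.ofArrows_pUnit] at this

instance [J.HasIsos] [J.IsStableUnderComposition] : (singletonCoverings J).IsMultiplicative where
  id_mem X := J.mem_coverings_of_isIso (𝟙 X)
  comp_mem {X Y Z} f g hf hg := by
    have hf' : Presieve.ofArrows (fun _ : PUnit.{1} ↦ X) (fun _ ↦ f) ∈ J Y := by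
      rw [Presieve.ofArrows_pUnit]
      exact hf
    have hg' : Presieve.ofArrows (fun _ : PUnit.{1} ↦ Y) (fun _ ↦ g) ∈ J Z := by
      rw [Presieve.ofArrows_pUnit]
      exact hg
    have := J.comp_mem_coverings _ hg' (fun _ _ ↦ f) (fun _ ↦ hf')
    have e : (Presieve.ofArrows (fun _ : Σ _ : PUnit.{1}, PUnit.{1} ↦ X) fun _ ↦ f ≫ g) =
        Presieve.singleton (f ≫ g) :=
      le_antisymm (fun _ _ ⟨_⟩ ↦ ⟨⟩) (fun _ _ ⟨⟩ ↦ ⟨⟨⟨⟩, ⟨⟩⟩⟩)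
    rwa [e] at this

end

variable (S : Scheme.{u})

/-- The morphisms of schemes over `S` that are coverings for the pro-étale topology. -/
def proEtCoverings : MorphismProperty (Over S) :=
  (singletonCoverings Scheme.proetalePrecoverage).inverseImage (Over.forget S)

instance : (proEtCoverings S).IsStableUnderBaseChange where
  of_isPullback sq h :=
    (singletonCoverings Scheme.proetalePrecoverage).of_isPullback (sq.map (Over.forget S)) h

instance : (proEtCoverings S).IsMultiplicative :=
  inferInstanceAs ((singletonCoverings _).inverseImage (Over.forget S)).IsMultiplicative

variable {S}

lemma isCovering_iff {X Y : S.ProEt} (f : X ⟶ Y) :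
    IsCovering f ↔ proEtCoverings S ((Scheme.ProEt.forget S).map f) := by
  unfold IsCovering Scheme.ProEt.precoverage
  rw [Precoverage.mem_comap_iff, Presieve.map_singleton]
  rfl

lemma weaklyEtale_of_proEtCoverings {X Y : Over S} {f : X ⟶ Y} (hf : proEtCoverings S f) :
    WeaklyEtale f.left :=
  ((Scheme.singleton_mem_precoverage_iff _ _).1
    (Scheme.propQCPrecoverage_le_precoverage _ hf)).2

/-- A covering of an object of the pro-étale site belongs to the pro-étale site. -/
lemma essImage_of_proEtCoverings {X Y : Over S} {f : X ⟶ Y} (hf : proEtCoverings S f)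
    (hY : (Scheme.ProEt.forget S).essImage Y) : (Scheme.ProEt.forget S).essImage X := by
  obtain ⟨Y', ⟨e⟩⟩ := hY
  have := weaklyEtale_of_proEtCoverings hf
  have hYhom : WeaklyEtale Y.hom := by
    have : WeaklyEtale ((Scheme.ProEt.forget S).obj Y').hom := Y'.prop
    have : IsIso (Over.Hom.left e.inv) := inferInstanceAs (IsIso ((Over.forget S).map e.inv))
    rw [← Over.w e.inv]
    infer_instance
  have : WeaklyEtale X.hom := by
    rw [← Over.w f]
    infer_instance
  exact ⟨Scheme.ProEt.mk X.hom, ⟨Over.isoMk (Iso.refl _)⟩⟩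

end Coverings

section Criterion

/-- There is exactly one map from the initial simplicial set. -/
def isTerminalMapsInto {C : Type w} [Category.{u} C] (A : Cᵒᵖ ⥤ SSet.{u}) {K : SSet.{u}}
    (hK : IsInitial K) : IsTerminal ((mapsInto A).obj (op K)) :=
  IsTerminal.ofUniqueHom (fun _ ↦ 
    { app T := ↾fun _ ↦ hK.to (A.obj T)
      naturality T T' f := by
        ext x
        exact hK.hom_ext (X := K) (Y := A.obj T') _ _ })
    (fun _ _ ↦ by
      ext T
      exact hK.hom_ext (X := K) (Y := A.obj T) _ _)

variable {S : Scheme.{u}}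

/-- The presheaf of simplicial sets on the category of schemes over `S` which is represented by a
simplicial object of the pro-étale site. -/
abbrev representedProEt : SimplicialObject S.ProEt ⥤ (Over S)ᵒᵖ ⥤ SSet.{u} :=
  represented (Scheme.ProEt.forget S)

/-- A simplicial object of the pro-étale site is a hypercovering if and only if
maps into it extend, locally for coverings, along the inclusions `∂Δ[n] ⟶ Δ[n]`. -/
lemma isHypercovering_iff (U : SimplicialObject S.ProEt) :
    IsHypercovering U ↔ ∀ n, fillable (proEtCoverings S) (representedProEt.obj U)
      (∂Δ[n] : SSet.Subcomplex.{u} _).ι := by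
  have h₀ : IsCovering (toBase (U _⦋0⦌)) ↔ fillable (proEtCoverings S) (representedProEt.obj U)
      (∂Δ[0] : SSet.Subcomplex.{u} _).ι := by
    have hS : IsTerminal ((Scheme.ProEt.forget S).obj (Scheme.ProEt.mk (𝟙 S))) :=
      Over.mkIdTerminal
    have hB : IsTerminal ((mapsInto (representedProEt.obj U)).obj (op (∂Δ[0] : SSet.{u}))) := 
      isTerminalMapsInto _ (by
        rw [SSet.boundary_zero]
        exact SSet.Subcomplex.isInitialBot)
    rw [isCovering_iff, fillable_iff, ← (proEtCoverings S).relative_map_iff (F := yoneda)]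
    refine ((proEtCoverings S).presheaf.arrow_mk_iso_iff (Arrow.isoMk
      (f := Arrow.mk ((mapsInto (representedProEt.obj U)).map
        (∂Δ[0] : SSet.Subcomplex.{u} _).ι.op))
      (mapsIntoRepresentedIso (Scheme.ProEt.forget S) U 0)
      (hB.uniqueUpToIso (hS.isTerminalObj yoneda _)) ?_)).symm
    exact (hS.isTerminalObj yoneda _).hom_ext _ _
  have h₁ (n : ℕ) : IsCovering (((SimplicialObject.coskAdj n).unit.app U).app (op ⦋n + 1⦌)) ↔
      fillable (proEtCoverings S) (representedProEt.obj U)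
        (∂Δ[n + 1] : SSet.Subcomplex.{u} _).ι := by
    rw [isCovering_iff]
    exact covering_cosk_iff _ _ U n
  refine ⟨fun h n ↦ ?_, fun h ↦ ⟨h₀.2 (h 0), fun n ↦ (h₁ n).2 (h (n + 1))⟩⟩
  obtain _ | n := n
  exacts [h₀.1 h.zero, (h₁ n).1 (h.succ n)]

end Criterion

/-! ### Relative path objects of hypercoverings -/

section PathObjects

open MonoidalCategory

instance mono_whiskerRight_of_cartesian {C : Type w} [Category.{v} C] [CartesianMonoidalCategory C]
    {X Y : C} (f : X ⟶ Y) [Mono f] (Z : C) : Mono (f ▷ Z) where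
  right_cancellation {T} g h w := by
    refine CartesianMonoidalCategory.hom_ext _ _ ?_ ?_
    · simpa [← cancel_mono f] using w =≫ CartesianMonoidalCategory.fst _ _
    · simpa using w =≫ CartesianMonoidalCategory.snd _ _

/-- A presheaf relatively representable over a representable presheaf is representable. -/
lemma exists_iso_yoneda_of_presheaf {C : Type w} [Category.{u} C] {P : MorphismProperty C}
    {X : Cᵒᵖ ⥤ Type u} {Y : C} {f : X ⟶ yoneda.obj Y} (hf : P.presheaf f) :
    ∃ (d : C) (g : d ⟶ Y), P g ∧ Nonempty (yoneda.obj d ≅ X) := by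
  let g : yoneda.obj Y ⟶ yoneda.obj Y := 𝟙 _
  have sq := hf.rep.isPullback g
  have : IsIso (hf.rep.fst g) := sq.isIso_fst_of_isIso
  exact ⟨hf.rep.pullback g, hf.rep.snd g, hf.property_snd g, ⟨asIso (hf.rep.fst g)⟩⟩

/-- A presheaf of simplicial sets that is levelwise representable by objects in the essential image
of a fully faithful functor is represented by a simplicial object. -/
lemma exists_iso_represented {C : Type w} [Category.{u} C] {D : Type w'} [Category.{u} D]
    (ι : D ⥤ C) [ι.Full] [ι.Faithful] (W : Cᵒᵖ ⥤ SSet.{u})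
    (hW : ∀ n : ℕ, ∃ d : C, ι.essImage d ∧
      Nonempty (yoneda.obj d ≅ W ⋙ (evaluation _ _).obj (op ⦋n⦌))) :
    ∃ U : SimplicialObject D, Nonempty ((represented ι).obj U ≅ W) := by
  let G : SimplexCategoryᵒᵖ ⥤ Cᵒᵖ ⥤ Type u := (flipFunctor _ _ _).obj W
  have hG (m : SimplexCategoryᵒᵖ) : (ι ⋙ yoneda).essImage (G.obj m) := by
    obtain ⟨d, ⟨d', ⟨e⟩⟩, ⟨e'⟩⟩ := hW m.unop.len
    exact ⟨d', ⟨yoneda.mapIso e ≪≫ e'⟩⟩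
  exact ⟨Functor.essImage.liftFunctor G (ι ⋙ yoneda) hG,
    ⟨(flipFunctor _ _ _).mapIso (Functor.essImage.liftFunctorCompIso G (ι ⋙ yoneda) hG)⟩⟩

variable {S : Scheme.{u}} {U V : SimplicialObject S.ProEt}

/-- Relative path objects of hypercoverings: for a finite simplicial set `L` with a subcomplex `K`,
the pullback of a map `U ⟶ V ^ K` along `V ^ L ⟶ V ^ K` is again a hypercovering. -/
lemma exists_hypercovering_isPullback (hU : IsHypercovering U) (hV : IsHypercovering V)
    {L : SSet.{u}} [L.Finite] (K : L.Subcomplex)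
    (φ : representedProEt.obj U ⟶ representedProEt.obj V ⋙ ihom (K : SSet.{u})) :
    ∃ (W : SimplicialObject S.ProEt) (_ : IsHypercovering W)
      (p : representedProEt.obj W ⟶ representedProEt.obj U)
      (q : representedProEt.obj W ⟶ representedProEt.obj V ⋙ ihom L),
      IsPullback p q φ (Functor.whiskerLeft _ (MonoidalClosed.pre K.ι)) := by
  rw [isHypercovering_iff] at hU hV
  let P := proEtCoverings S
  let ψ : representedProEt.obj V ⋙ ihom L ⟶ representedProEt.obj V ⋙ ihom (K : SSet.{u}) :=
    Functor.whiskerLeft _ (MonoidalClosed.pre K.ι)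
  have sq := IsPullback.of_hasPullback φ ψ
  have hW (n : ℕ) : ∃ d : Over S, (Scheme.ProEt.forget S).essImage d ∧
      Nonempty (yoneda.obj d ≅ pullback φ ψ ⋙ (evaluation _ _).obj (op ⦋n⦌)) := by
    have := P.relative_isStableUnderBaseChange (F := yoneda)
    -- The projection `W_n ⟶ U_n` is a base change of `Hom(L ⊗ Δ[n], V) ⟶ Hom(K ⊗ Δ[n], V)`.
    have h : P.presheaf ((Functor.whiskerRight (pullback.fst φ ψ) (coyoneda.obj (op Δ[n])) :
        (mapsInto (pullback φ ψ)).obj (op Δ[n]) ⟶ _)) :=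
      P.presheaf.of_isPullback (isPullback_uncurryMaps sq Δ[n]).flip
        (fillable_of_mono hV (K.ι ▷ (Δ[n] : SSet.{u})))
    obtain ⟨d, g, hg, ⟨e⟩⟩ := exists_iso_yoneda_of_presheaf
      ((P.presheaf.cancel_right_of_respectsIso _
        (mapsIntoRepresentedIso (Scheme.ProEt.forget S) U n).hom).2 h)
    exact ⟨d, essImage_of_proEtCoverings hg (Functor.obj_mem_essImage _ _),
      ⟨e ≪≫ mapsIntoStdSimplexIso _ n⟩⟩
  obtain ⟨W, ⟨e⟩⟩ := exists_iso_represented (Scheme.ProEt.forget S) _ hW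
  have sq' : IsPullback (e.hom ≫ pullback.fst φ ψ) (e.hom ≫ pullback.snd φ ψ) φ ψ :=
    sq.of_iso e.symm (Iso.refl _) (Iso.refl _) (Iso.refl _) (by simp) (by simp) (by simp) (by simp)
  -- The inclusion of `(L ⊗ ∂Δ[n]) ∪ (K ⊗ Δ[n])` into the finite simplicial set `L ⊗ Δ[n]` is
  -- fillable for `V`.
  refine ⟨W, (isHypercovering_iff W).2 fun n ↦ ?_, _, _, sq'⟩
  exact fillable_of_isPullback K _ sq' (hU n) (fillable_of_mono hV _)

end PathObjects

/-! ### Homotopies given by path objects -/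

section Homotopies

open MonoidalCategory CartesianMonoidalCategory

variable {C : Type w} [Category.{u} C] {D : Type w'} [Category.{u} D]

/-- Simplicial objects embed fully faithfully into presheaves of simplicial sets. -/
def fullyFaithfulRepresented (ι : D ⥤ C) [ι.Full] [ι.Faithful] :
    (represented ι).FullyFaithful :=
  ((Functor.FullyFaithful.ofFullyFaithful (ι ⋙ yoneda)).whiskeringRight SimplexCategoryᵒᵖ).comp
    Functor.flipping.fullyFaithfulFunctor

lemma homotopy_h_naturality {X X' Y Y' : SSet.{u}} {f g : X ⟶ Y} {f' g' : X' ⟶ Y'}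
    (H : SSet.Homotopy f g) (H' : SSet.Homotopy f' g') {a : X ⟶ X'} {b : Y ⟶ Y'}
    (h : a ▷ Δ[1] ≫ H'.h = H.h ≫ b) {n : ℕ} (i : Fin (n + 1)) :
    a.app (op ⦋n⦌) ≫ H'.toSimplicialObjectHomotopy.h i =
      H.toSimplicialObjectHomotopy.h i ≫ b.app (op ⦋n + 1⦌) := by
  ext x
  have hx : SSet.yonedaEquiv.symm (a.app _ x) = SSet.yonedaEquiv.symm x ≫ a :=
    SSet.yonedaEquiv.symm_apply_eq.2 (by rw [SSet.yonedaEquiv_comp, Equiv.apply_symm_apply])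
  change (SSet.yonedaEquiv.symm (a.app _ x) ▷ Δ[1] ≫ H'.h).app _
      (SSet.prodStdSimplex.nonDegenerateEquiv₁ i).1 =
    ((SSet.yonedaEquiv.symm x ▷ Δ[1] ≫ H.h) ≫ b).app _
      (SSet.prodStdSimplex.nonDegenerateEquiv₁ i).1
  rw [hx, comp_whiskerRight, Category.assoc, Category.assoc, h]

/-- A simplicial homotopy between morphisms of simplicial objects may be given as a natural
homotopy between the induced morphisms of simplicial sets of points. -/
def homotopyOfRepresented (ι : D ⥤ C) [ι.Full] [ι.Faithful] {U V : SimplicialObject D}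
    {f g : U ⟶ V}
    (H : ∀ T : Cᵒᵖ, SSet.Homotopy (((represented ι).map f).app T) (((represented ι).map g).app T))
    (hH : ∀ ⦃T T' : Cᵒᵖ⦄ (a : T ⟶ T'), ((represented ι).obj U).map a ▷ Δ[1] ≫ (H T').h =
      (H T).h ≫ ((represented ι).obj V).map a) :
    SimplicialObject.Homotopy f g :=
  let y := ι ⋙ yoneda
  let K (T : Cᵒᵖ) := (H T).toSimplicialObjectHomotopy
  have hy {X Y : D} (a : y.obj X ⟶ y.obj Y) : y.map (y.preimage a) = a := y.map_preimage a
  { h {n} i := y.preimage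
      { app T := (K T).h i
        naturality T T' a := by
          exact homotopy_h_naturality (H T) (H T') (hH a) i }
    h_zero_comp_δ_zero n := y.map_injective (by
      rw [y.map_comp, hy]
      exact NatTrans.ext (funext fun T ↦ (K T).h_zero_comp_δ_zero n))
    h_last_comp_δ_last n := y.map_injective (by
      rw [y.map_comp, hy]
      exact NatTrans.ext (funext fun T ↦ (K T).h_last_comp_δ_last n))
    h_succ_comp_δ_castSucc_of_lt i j hij := y.map_injective (by
      rw [y.map_comp, y.map_comp, hy, hy]
      exact NatTrans.ext (funext fun T ↦ (K T).h_succ_comp_δ_castSucc_of_lt i j hij))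
    h_succ_comp_δ_castSucc_succ j := y.map_injective (by
      rw [y.map_comp, y.map_comp, hy, hy]
      exact NatTrans.ext (funext fun T ↦ (K T).h_succ_comp_δ_castSucc_succ j))
    h_castSucc_comp_δ_succ_of_lt i j hij := y.map_injective (by
      rw [y.map_comp, y.map_comp, hy, hy]
      exact NatTrans.ext (funext fun T ↦ (K T).h_castSucc_comp_δ_succ_of_lt i j hij))
    h_comp_σ_castSucc_of_le i j hij := y.map_injective (by
      rw [y.map_comp, y.map_comp, hy, hy]
      exact NatTrans.ext (funext fun T ↦ (K T).h_comp_σ_castSucc_of_le i j hij))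
    h_comp_σ_succ_of_lt i j hij := y.map_injective (by
      rw [y.map_comp, y.map_comp, hy, hy]
      exact NatTrans.ext (funext fun T ↦ (K T).h_comp_σ_succ_of_lt i j hij)) }

variable {E : Type w} [Category.{v} E]

/-- Currying of natural transformations between diagrams of simplicial sets. -/
def curryMap {K : SSet.{u}} {A B : E ⥤ SSet.{u}} (c : A ⋙ tensorLeft K ⟶ B) : A ⟶ B ⋙ ihom K where
  app T := MonoidalClosed.curry (c.app T)
  naturality T T' a := by
    have h : K ◁ A.map a ≫ c.app T' = c.app T ≫ B.map a := c.naturality a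
    dsimp
    rw [← MonoidalClosed.curry_natural_left, ← MonoidalClosed.curry_natural_right, h]

/-- The simplices of `∂Δ[1]` are constant. -/
lemma asOrderHom_eq_of_mem_boundary_one {m : SimplexCategoryᵒᵖ} {k : (Δ[1] : SSet.{u}).obj m}
    (hk : k ∈ (∂Δ[1] : SSet.Subcomplex.{u} _).obj m) (i j : Fin (m.unop.len + 1)) :
    SSet.stdSimplex.asOrderHom k i = SSet.stdSimplex.asOrderHom k j := by
  by_contra h
  refine hk fun a ↦ ?_
  obtain ha | ha : SSet.stdSimplex.asOrderHom k i = a ∨ SSet.stdSimplex.asOrderHom k j = a := by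
    generalize SSet.stdSimplex.asOrderHom k i = b at h
    generalize SSet.stdSimplex.asOrderHom k j = c at h
    lia
  exacts [⟨i, ha⟩, ⟨j, ha⟩]

open Classical in
/-- The map `∂Δ[1] ⊗ A ⟶ B` which is equal to `f` on `{0} ⊗ A` and to `g` on `{1} ⊗ A`. -/
def boundaryOneMap {A B : E ⥤ SSet.{u}} (f g : A ⟶ B) :
    A ⋙ tensorLeft (∂Δ[1] : SSet.{u}) ⟶ B where
  app T :=
    { app m := ↾fun x : (∂Δ[1] : SSet.Subcomplex.{u} _).obj m × (A.obj T).obj m ↦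
        if SSet.stdSimplex.asOrderHom x.1.1 0 = 0 then (f.app T).app m x.2 else
          (g.app T).app m x.2
      naturality m m' a := by
        ext ⟨k, x⟩
        have hk : SSet.stdSimplex.asOrderHom ((∂Δ[1] : SSet.{u}).map a k).1 0 =
            SSet.stdSimplex.asOrderHom k.1 0 :=
          asOrderHom_eq_of_mem_boundary_one k.2 _ _
        change (if SSet.stdSimplex.asOrderHom ((∂Δ[1] : SSet.{u}).map a k).1 0 = 0 then
            (f.app T).app m' ((A.obj T).map a x) else (g.app T).app m' ((A.obj T).map a x)) =
          (B.obj T).map a (if SSet.stdSimplex.asOrderHom k.1 0 = 0 then (f.app T).app m x else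
            (g.app T).app m x)
        rw [hk]
        split_ifs
        exacts [NatTrans.naturality_apply _ _ _, NatTrans.naturality_apply _ _ _] }
  naturality T T' a := by
    ext m ⟨k, x⟩
    change (if SSet.stdSimplex.asOrderHom k.1 0 = 0 then
        (f.app T').app m ((A.map a).app m x) else (g.app T').app m ((A.map a).app m x)) =
      (B.map a).app m (if SSet.stdSimplex.asOrderHom k.1 0 = 0 then (f.app T).app m x else
        (g.app T).app m x)
    split_ifs
    · exact congrArg (fun φ ↦ φ.app m x) (f.naturality a)
    · exact congrArg (fun φ ↦ φ.app m x) (g.naturality a)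

lemma boundaryOneMap_app_apply {E : Type w} [Category.{v} E] {A B : E ⥤ SSet.{u}} (f g : A ⟶ B)
    {T : E} {m : SimplexCategoryᵒᵖ} (k : (∂Δ[1] : SSet.{u}).obj m) (x : (A.obj T).obj m) :
    ((boundaryOneMap f g).app T).app m (k, x) =
      if SSet.stdSimplex.asOrderHom k.1 0 = 0 then (f.app T).app m x else (g.app T).app m x := rfl

end Homotopies

/-! ### The homotopy category of pointed hypercoverings is cofiltered -/

section Cofiltered

open MonoidalCategory CartesianMonoidalCategory

variable {S : Scheme.{u}} {Ω : Type u} [Field Ω] {s : Spec (.of Ω) ⟶ S}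

/-- Relative path objects of pointed hypercoverings. The base point of the path object is
given by the base point of `X` and an `L`-simplex `w` of the fibre of `Y`. -/
lemma exists_pointedHy_isPullback (X Y : PointedHy s) {L : SSet.{u}} [L.Finite] (K : L.Subcomplex)
    (φ : representedProEt.obj X.right.obj ⟶
      representedProEt.obj Y.right.obj ⋙ ihom (K : SSet.{u}))
    (w : Δ[0] ⟶ (ihom L).obj ((hyFiber s).obj Y.right))
    (hw : X.hom ≫ φ.app (op (Over.mk s)) = w ≫ (MonoidalClosed.pre K.ι).app _) :
    ∃ (Z : PointedHy s) (p : Z ⟶ X)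
      (q : representedProEt.obj Z.right.obj ⟶ representedProEt.obj Y.right.obj ⋙ ihom L),
      IsPullback (representedProEt.map p.right.hom) q φ
        (Functor.whiskerLeft _ (MonoidalClosed.pre K.ι)) ∧ Z.hom ≫ q.app (op (Over.mk s)) = w := by
  obtain ⟨W, hW, p, q, sq⟩ := exists_hypercovering_isPullback X.right.property Y.right.property K φ
  let F := fullyFaithfulRepresented (Scheme.ProEt.forget S)
  have hp : representedProEt.map (F.preimage p) = p := F.map_preimage p
  have sq₀ := sq.map ((evaluation _ _).obj (op (Over.mk s)))
  let W' : Hy S := ⟨W, hW⟩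
  let z : Δ[0] ⟶ (hyFiber s).obj W' := sq₀.lift X.hom w hw
  have hz₁ : z ≫ p.app (op (Over.mk s)) = X.hom := sq₀.lift_fst _ _ hw
  have hz₂ : z ≫ q.app (op (Over.mk s)) = w := sq₀.lift_snd _ _ hw
  refine ⟨StructuredArrow.mk z, StructuredArrow.homMk (ObjectProperty.homMk (F.preimage p)) ?_, q,
    ?_, hz₂⟩
  · rw [← hp] at hz₁
    exact hz₁
  · rw [← hp] at sq
    exact sq

lemma vertex_mem_boundary_one (a : Fin 2) (m : SimplexCategoryᵒᵖ) :
    (Δ[1] : SSet.{u}).map (m.unop.const _ 0).op (SSet.stdSimplex.obj₀Equiv.symm a) ∈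
      (∂Δ[1] : SSet.Subcomplex.{u} _).obj m := by
  intro h
  obtain ⟨i, hi⟩ := h 0
  obtain ⟨j, hj⟩ := h 1
  exact zero_ne_one (α := Fin 2) (hi.symm.trans hj)

lemma whiskerLeft_comp_uncurry {L M M' N N' : SSet.{u}} {a : M ⟶ M'} {b : N ⟶ N'}
    {q : M ⟶ (ihom L).obj N} {q' : M' ⟶ (ihom L).obj N'} (h : a ≫ q' = q ≫ (ihom L).map b) :
    L ◁ a ≫ MonoidalClosed.uncurry q' = MonoidalClosed.uncurry q ≫ b := by
  rw [← MonoidalClosed.uncurry_natural_left, h, MonoidalClosed.uncurry_natural_right]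

/-- Two pointed hypercoverings have a common refinement: their product. -/
lemma pointedHy_cone_objs (X Y : PointedHy s) :
    ∃ Z : PointedHy s, Nonempty (Z ⟶ X) ∧ Nonempty (Z ⟶ Y) := by
  let A := representedProEt.obj X.right.obj
  let B := representedProEt.obj Y.right.obj
  have hbot {M N : SSet.{u}} (a b : ((⊥ : (Δ[0] : SSet.{u}).Subcomplex) : SSet.{u}) ⊗ M ⟶ N) :
      a = b := by
    ext m ⟨x, y⟩
    exact x.2.elim
  let φ : A ⟶ B ⋙ ihom ((⊥ : (Δ[0] : SSet.{u}).Subcomplex) : SSet.{u}) := curryMap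
    { app T := fst _ _ ≫ SSet.Subcomplex.isInitialBot.to _
      naturality _ _ _ := hbot _ _ }
  let w : Δ[0] ⟶ (ihom Δ[0]).obj ((hyFiber s).obj Y.right) :=
    MonoidalClosed.curry (snd _ _ ≫ Y.hom)
  obtain ⟨Z, p, q, sq, hZ⟩ := exists_pointedHy_isPullback X Y ⊥ φ w
    (MonoidalClosed.uncurry_injective (hbot _ _))
  -- Evaluation at the unique vertex identifies maps into `Y ^ Δ[0]` with maps into `Y`.
  let r (M : SSet.{u}) : M ⟶ Δ[0] ⊗ M := lift (SSet.stdSimplex.isTerminalObj₀.from M) (𝟙 M)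
  have hr {M N : SSet.{u}} (a : M ⟶ N) : a ≫ r N = r M ≫ Δ[0] ◁ a :=
    CartesianMonoidalCategory.hom_ext _ _ (SSet.stdSimplex.isTerminalObj₀.hom_ext _ _) (by simp [r])
  have hr' {M N N' : SSet.{u}} (a : M ⟶ N) (b : N ⟶ (ihom Δ[0]).obj N') (y : M ⟶ N')
      (h : a ≫ b = MonoidalClosed.curry (snd _ _ ≫ y)) :
      a ≫ r N ≫ MonoidalClosed.uncurry b = y := by
    rw [reassoc_of% hr, ← MonoidalClosed.uncurry_natural_left, h]
    simp [r]
  let q₀ : representedProEt.obj Z.right.obj ⟶ B :=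
    { app T := r _ ≫ MonoidalClosed.uncurry (q.app T)
      naturality T T' a := by
        rw [reassoc_of% hr, Category.assoc]
        exact congrArg (r _ ≫ ·) (whiskerLeft_comp_uncurry (q.naturality a)) }
  let F := fullyFaithfulRepresented (Scheme.ProEt.forget S)
  refine ⟨Z, ⟨p⟩, ⟨StructuredArrow.homMk (ObjectProperty.homMk (F.preimage q₀)) ?_⟩⟩
  have h : Z.hom ≫ q₀.app (op (Over.mk s)) = Y.hom := hr' Z.hom (q.app (op (Over.mk s))) Y.hom hZ
  rw [← F.map_preimage q₀] at h
  exact h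

section

variable {E : Type w} [Category.{v} E] {A B W : E ⥤ SSet.{u}} {f g : A ⟶ B} {p : W ⟶ A}
  {q : W ⟶ B ⋙ ihom Δ[1]}

/-- The endpoints of the paths parametrised by `q` are the values of `f` and `g`. -/
lemma uncurry_app_of_pathObject (h : p ≫ curryMap (boundaryOneMap f g) =
      q ≫ Functor.whiskerLeft B (MonoidalClosed.pre (∂Δ[1] : SSet.Subcomplex.{u} _).ι)) (T : E)
    {m : SimplexCategoryᵒᵖ} (k : (∂Δ[1] : SSet.{u}).obj m) (z : (W.obj T).obj m) :
    (MonoidalClosed.uncurry (q.app T)).app m (k.1, z) =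
      if SSet.stdSimplex.asOrderHom k.1 0 = 0 then (f.app T).app m ((p.app T).app m z) else
        (g.app T).app m ((p.app T).app m z) := by
  have h' : p.app T ≫ MonoidalClosed.curry ((boundaryOneMap f g).app T) =
      q.app T ≫ (MonoidalClosed.pre (∂Δ[1] : SSet.Subcomplex.{u} _).ι).app (B.obj T) :=
    congrArg (fun φ ↦ φ.app T) h
  have hq := congrArg MonoidalClosed.uncurry h'
  rw [MonoidalClosed.uncurry_natural_left, MonoidalClosed.uncurry_curry,
    MonoidalClosed.uncurry_pre_app] at hq
  exact congrArg (fun φ ↦ φ.app m (k, z)) hq.symm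

/-- A map into the object of paths between the values of `f` and `g` gives a homotopy. -/
def homotopyOfPathObject (h : p ≫ curryMap (boundaryOneMap f g) =
      q ≫ Functor.whiskerLeft B (MonoidalClosed.pre (∂Δ[1] : SSet.Subcomplex.{u} _).ι)) (T : E) :
    SSet.Homotopy ((p ≫ f).app T) ((p ≫ g).app T) where
  h := (β_ _ _).hom ≫ MonoidalClosed.uncurry (q.app T)
  h₀ := by
    ext m z
    exact (uncurry_app_of_pathObject h T ⟨_, vertex_mem_boundary_one 0 m⟩ z).trans (if_pos rfl)
  h₁ := by
    ext m z
    exact (uncurry_app_of_pathObject h T ⟨_, vertex_mem_boundary_one 1 m⟩ z).trans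
      (if_neg (one_ne_zero (α := Fin 2)))
  rel := by
    ext m ⟨z, _⟩
    exact z.2.elim

lemma homotopyOfPathObject_naturality (h : p ≫ curryMap (boundaryOneMap f g) =
      q ≫ Functor.whiskerLeft B (MonoidalClosed.pre (∂Δ[1] : SSet.Subcomplex.{u} _).ι))
    {T T' : E} (a : T ⟶ T') :
    W.map a ▷ Δ[1] ≫ (homotopyOfPathObject h T').h = (homotopyOfPathObject h T).h ≫ B.map a := by
  dsimp only [homotopyOfPathObject]
  rw [BraidedCategory.braiding_naturality_left_assoc, Category.assoc]
  exact congrArg (_ ≫ ·) (whiskerLeft_comp_uncurry (q.naturality a))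

end

/-- At a point `x` with `f(x) = y = g(x)`, the constant path at `y` joins `f(x)` to `g(x)`. -/
lemma comp_curryMap_boundaryOneMap {E : Type w} [Category.{v} E] {A B : E ⥤ SSet.{u}}
    (f g : A ⟶ B) {T : E} {M : SSet.{u}} (x : M ⟶ A.obj T) (y : M ⟶ B.obj T)
    (hf : x ≫ f.app T = y) (hg : x ≫ g.app T = y) :
    x ≫ (curryMap (boundaryOneMap f g)).app T = MonoidalClosed.curry (snd Δ[1] M ≫ y) ≫
      (MonoidalClosed.pre (∂Δ[1] : SSet.Subcomplex.{u} _).ι).app _ := by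
  refine (MonoidalClosed.curry_natural_left _ _).symm.trans
    ((congrArg MonoidalClosed.curry ?_).trans (MonoidalClosed.curry_pre_app _ _).symm)
  ext m ⟨k, t⟩
  refine (ite_eq_iff'.2 ⟨fun _ ↦ ?_, fun _ ↦ ?_⟩ :
    (if SSet.stdSimplex.asOrderHom k.1 0 = 0 then (f.app T).app m (x.app m t) else
      (g.app T).app m (x.app m t)) = y.app m t)
  · exact congrArg (fun φ ↦ φ.app m t) hf
  · exact congrArg (fun φ ↦ φ.app m t) hg

/-- Two morphisms of pointed hypercoverings become homotopic on a refinement: the object of paths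
between their values. -/
lemma pointedHy_cone_maps {X Y : PointedHy s} (f g : X ⟶ Y) :
    ∃ (Z : PointedHy s) (p : Z ⟶ X),
      homotopyRel (PointedHy.toSimplicial s) (p ≫ f) (p ≫ g) := by
  let f' := representedProEt.map f.right.hom
  let g' := representedProEt.map g.right.hom
  have hw := comp_curryMap_boundaryOneMap f' g' (T := op (Over.mk s)) X.hom Y.hom
    (StructuredArrow.w f) (StructuredArrow.w g)
  obtain ⟨Z, p, q, sq, -⟩ := exists_pointedHy_isPullback X Y _ (curryMap (boundaryOneMap f' g'))
    (MonoidalClosed.curry (snd Δ[1] Δ[0] ≫ Y.hom)) hw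
  have H : SimplicialObject.Homotopy (p.right.hom ≫ f.right.hom) (p.right.hom ≫ g.right.hom) := by
    refine homotopyOfRepresented (Scheme.ProEt.forget S) (homotopyOfPathObject sq.w) ?_
    intro T T' a
    exact homotopyOfPathObject_naturality sq.w a
  exact ⟨Z, p, ⟨H⟩⟩

/-- The constant simplicial object on the final object is a hypercovering. -/
lemma isHypercovering_const (S : Scheme.{u}) :
    IsHypercovering ((SimplicialObject.const S.ProEt).obj (Scheme.ProEt.mk (𝟙 S))) := by
  let t : IsTerminal ((Scheme.ProEt.forget S).obj (Scheme.ProEt.mk (𝟙 S))) := Over.mkIdTerminal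
  rw [isHypercovering_iff]
  intro n
  have h (K : SSet.{u}) (T : (Over S)ᵒᵖ) : Unique (K ⟶ (representedProEt.obj
      ((SimplicialObject.const S.ProEt).obj (Scheme.ProEt.mk (𝟙 S)))).obj T) :=
    { default := { app _ := ↾fun _ ↦ t.from T.unop }
      uniq _ := by
        ext
        exact t.hom_ext _ _ }
  have h' : IsIso ((mapsInto (representedProEt.obj ((SimplicialObject.const S.ProEt).obj
      (Scheme.ProEt.mk (𝟙 S))))).map (∂Δ[n] : SSet.Subcomplex.{u} _).ι.op) := by
    have h₀ (T : (Over S)ᵒᵖ) : IsIso (((mapsInto (representedProEt.obj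
        ((SimplicialObject.const S.ProEt).obj (Scheme.ProEt.mk (𝟙 S))))).map
          (∂Δ[n] : SSet.Subcomplex.{u} _).ι.op).app T) := by
      rw [isIso_iff_bijective]
      exact ⟨fun a b _ ↦ (h _ T).eq_default a |>.trans ((h _ T).eq_default b).symm,
        fun b ↦ ⟨(h _ T).default, ((h _ T).eq_default _).trans ((h _ T).eq_default b).symm⟩⟩
    exact NatIso.isIso_of_isIso_app _
  exact (proEtCoverings S).presheaf.of_isIso _

instance : Nonempty (PointedHy s) :=
  ⟨StructuredArrow.mk (Y := (⟨_, isHypercovering_const S⟩ : Hy S))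
    { app _ := ↾fun _ ↦ Over.mkIdTerminal.from (Over.mk s)
      naturality _ _ _ := by
        ext
        exact Over.mkIdTerminal.hom_ext _ _ }⟩

lemma isCofiltered_hoPointedHy (s : Spec (.of Ω) ⟶ S) : IsCofiltered (HoPointedHy s) where
  cone_objs X Y := by
    obtain ⟨Z, ⟨f⟩, ⟨g⟩⟩ := pointedHy_cone_objs X.as Y.as
    exact ⟨⟨Z⟩, (CategoryTheory.Quotient.functor _).map f,
      (CategoryTheory.Quotient.functor _).map g, trivial⟩
  cone_maps X Y f g := by
    obtain ⟨f, rfl⟩ := (CategoryTheory.Quotient.functor (homotopyRel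
      (PointedHy.toSimplicial s))).map_surjective (X := X.as) (Y := Y.as) f
    obtain ⟨g, rfl⟩ := (CategoryTheory.Quotient.functor (homotopyRel
      (PointedHy.toSimplicial s))).map_surjective (X := X.as) (Y := Y.as) g
    obtain ⟨Z, p, hp⟩ := pointedHy_cone_maps f g
    exact ⟨⟨Z⟩, (CategoryTheory.Quotient.functor _).map p, CategoryTheory.Quotient.sound _ hp⟩
  nonempty := ⟨⟨Classical.arbitrary (PointedHy s)⟩⟩

end Cofiltered

/-! ### Descent of continuous maps along hypercoverings -/

section Descent

open MonoidalCategory CartesianMonoidalCategory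

/-- A vertex of `∂Δ[1]`. -/
def boundaryOneVertex (a : Fin 2) : (Δ[0] : SSet.{u}) ⟶ (∂Δ[1] : SSet.{u}) :=
  SSet.const ⟨SSet.stdSimplex.obj₀Equiv.symm a, by
    have := vertex_mem_boundary_one.{u} a (op ⦋0⦌)
    exact this⟩

lemma exists_boundaryOne_desc {N : SSet.{u}} (x₀ x₁ : Δ[0] ⟶ N) :
    ∃ b : (∂Δ[1] : SSet.{u}) ⟶ N, boundaryOneVertex 0 ≫ b = x₀ ∧ boundaryOneVertex 1 ≫ b = x₁ := by
  have hz (a : Fin 2) {m : SimplexCategoryᵒᵖ} (z : (Δ[0] : SSet.{u}).obj m) :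
      (SSet.stdSimplex.isTerminalObj₀.from (∂Δ[1] : SSet.{u})).app m
        ((boundaryOneVertex a).app m z) = z :=
    congrArg (fun φ : (Δ[0] : SSet.{u}) ⟶ Δ[0] ↦ φ.app m z) (SSet.stdSimplex.isTerminalObj₀.hom_ext
      (boundaryOneVertex a ≫ SSet.stdSimplex.isTerminalObj₀.from _) (𝟙 _))
  let f₀ := (Functor.const (Discrete PUnit.{1})).map x₀
  let f₁ := (Functor.const (Discrete PUnit.{1})).map x₁
  have hb (a : Fin 2) {m : SimplexCategoryᵒᵖ} (z : (Δ[0] : SSet.{u}).obj m) :=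
    boundaryOneMap_app_apply f₀ f₁ (T := ⟨⟨⟩⟩) ((boundaryOneVertex a).app m z)
      ((SSet.stdSimplex.isTerminalObj₀.from (∂Δ[1] : SSet.{u})).app m
        ((boundaryOneVertex a).app m z))
  refine ⟨lift (𝟙 _) (SSet.stdSimplex.isTerminalObj₀.from _) ≫
    (boundaryOneMap f₀ f₁).app ⟨⟨⟩⟩, ?_, ?_⟩
  · ext m z
    refine (hb 0 z).trans ((if_pos rfl).trans ?_)
    exact congrArg (x₀.app m) (hz 0 z)
  · ext m z
    refine (hb 1 z).trans ((if_neg (one_ne_zero (α := Fin 2))).trans ?_)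
    exact congrArg (x₁.app m) (hz 1 z)

variable {S : Scheme.{u}} {U : SimplicialObject S.ProEt}

/-- For a hypercovering `U`, two points of `U₀` are locally the endpoints of a point of `U₁`. -/
lemma exists_covering_lift (hU : IsHypercovering U) {T : Over S}
    (x₀ x₁ : T ⟶ (Scheme.ProEt.forget S).obj (U _⦋0⦌)) :
    ∃ (Q : Over S) (q : Q ⟶ T) (_ : proEtCoverings S q)
      (y : Q ⟶ (Scheme.ProEt.forget S).obj (U _⦋1⦌)),
      y ≫ (Scheme.ProEt.forget S).map (U.δ 1) = q ≫ x₀ ∧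
        y ≫ (Scheme.ProEt.forget S).map (U.δ 0) = q ≫ x₁ := by
  let A := representedProEt.obj U
  obtain ⟨b, hb₀, hb₁⟩ := exists_boundaryOne_desc
    ((SSet.yonedaEquiv (X := A.obj (op T))).symm x₀)
    ((SSet.yonedaEquiv (X := A.obj (op T))).symm x₁)
  replace hb₀ := (congrArg SSet.yonedaEquiv hb₀).trans (Equiv.apply_symm_apply _ _)
  replace hb₁ := (congrArg SSet.yonedaEquiv hb₁).trans (Equiv.apply_symm_apply _ _)
  have h := (isHypercovering_iff U).1 hU 1
  rw [fillable_iff] at h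
  let b' : yoneda.obj T ⟶ (mapsInto A).obj (op (∂Δ[1] : SSet.{u})) := yonedaEquiv.symm b
  let Q := h.rep.pullback b'
  let q : Q ⟶ T := h.rep.snd b'
  let e : Δ[1] ⟶ A.obj (op Q) := (h.rep.fst b').app (op Q) (𝟙 Q)
  have sq := h.rep.isPullback b'
  -- By the commutativity of `sq`, the path `e` in `U(Q)` joins the restrictions of `x₀` and `x₁`.
  have he : (∂Δ[1] : SSet.Subcomplex.{u} _).ι ≫ e = b ≫ A.map q.op := by
    refine (congrArg (fun φ ↦ φ.app (op Q) (𝟙 Q)) sq.w).trans ?_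
    change b'.app (op Q) (𝟙 Q ≫ q) = _
    rw [Category.id_comp]
    rfl
  have key (a : Fin 2) (i : Fin 2)
      (ha : SSet.stdSimplex.{u}.δ i = SSet.const (SSet.stdSimplex.obj₀Equiv.symm a)) :
      (A.obj (op Q)).δ i (SSet.yonedaEquiv e) =
        (A.map q.op).app _ (SSet.yonedaEquiv (boundaryOneVertex a ≫ b)) := by
    have ha' : SSet.stdSimplex.{u}.δ i =
      boundaryOneVertex a ≫ (∂Δ[1] : SSet.Subcomplex.{u} _).ι := ha
    rw [← SSet.stdSimplex.yonedaEquiv_δ_comp, ha', Category.assoc, he, ← Category.assoc,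
      SSet.yonedaEquiv_comp]
  exact ⟨Q, q, h.property_snd b', SSet.yonedaEquiv e,
    (key 0 1 SSet.stdSimplex.δ_one_eq_const).trans (congrArg ((A.map q.op).app _) hb₀),
    (key 1 0 SSet.stdSimplex.δ_zero_eq_const).trans (congrArg ((A.map q.op).app _) hb₁)⟩

lemma surjective_of_proEtCoverings {X Y : Over S} {f : X ⟶ Y} (hf : proEtCoverings S f) :
    Function.Surjective f.left :=
  ((Scheme.singleton_mem_precoverage_iff _ _).1
    (Scheme.propQCPrecoverage_le_precoverage _ hf)).1

/-- Continuous maps descend along coverings of the pro-étale topology. -/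
lemma isSheafFor_continuousMap {X Y : Over S} {f : X ⟶ Y} (hf : proEtCoverings S f)
    (T : Type u) [TopologicalSpace T] :
    (Presieve.singleton f.left).IsSheafFor (continuousMapPresheaf T) := by
  have h := (isSheaf_iff_isSheaf_of_type _ _).1 (isSheaf_fpqcTopology_continuousMapPresheaf.{u} T)
  rw [Presieve.isSheafFor_iff_generate]
  exact h _ (Scheme.proetaleTopology_le_fpqcTopology _
    (Precoverage.generate_mem_toGrothendieck hf))

lemma surjective_hom_of_isHypercovering (hU : IsHypercovering U) :
    Function.Surjective (U _⦋0⦌).hom :=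
  surjective_of_proEtCoverings ((isCovering_iff _).1 hU.zero)

/-- The space underlying `S` is the coequaliser of `U₁ ⇉ U₀`, for a hypercovering `U` of `S`. -/
lemma exists_continuousMap_desc (hU : IsHypercovering U) {T : TopCat.{u}}
    (g : Scheme.forgetToTop.obj (U _⦋0⦌).left ⟶ T)
    (hg : Scheme.forgetToTop.map (U.δ 0).left ≫ g = Scheme.forgetToTop.map (U.δ 1).left ≫ g) :
    ∃ h : Scheme.forgetToTop.obj S ⟶ T, Scheme.forgetToTop.map (U _⦋0⦌).hom ≫ h = g := by
  have hS := isSheafFor_continuousMap ((isCovering_iff _).1 hU.zero) T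
  rw [Presieve.isSheafFor_singleton] at hS
  obtain ⟨h, hh, -⟩ := hS g.hom (fun {Z} p₀ p₁ hp ↦ by
    let x₀ : Over.mk (p₀ ≫ (U _⦋0⦌).hom) ⟶ (Scheme.ProEt.forget S).obj (U _⦋0⦌) := Over.homMk p₀
    let x₁ : Over.mk (p₀ ≫ (U _⦋0⦌).hom) ⟶ (Scheme.ProEt.forget S).obj (U _⦋0⦌) :=
      Over.homMk p₁ hp.symm
    obtain ⟨Q, q, hq, y, h₀, h₁⟩ := exists_covering_lift hU x₀ x₁
    refine ContinuousMap.ext fun z ↦ ?_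
    obtain ⟨z, rfl⟩ := surjective_of_proEtCoverings hq z
    have e₀ : y.left ≫ (U.δ 1).left = q.left ≫ p₀ := congrArg CommaMorphism.left h₀
    have e₁ : y.left ≫ (U.δ 0).left = q.left ≫ p₁ := congrArg CommaMorphism.left h₁
    calc g (p₀ (q.left z)) = g ((U.δ 1).left (y.left z)) :=
          congrArg (fun φ : Q.left ⟶ (U _⦋0⦌).left ↦ g (φ z)) e₀.symm
      _ = g ((U.δ 0).left (y.left z)) := (congrArg (fun φ ↦ φ (y.left z)) hg).symm
      _ = g (p₁ (q.left z)) := congrArg (fun φ : Q.left ⟶ (U _⦋0⦌).left ↦ g (φ z)) e₁)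
  exact ⟨TopCat.ofHom h, by
    ext x
    exact congrArg (fun φ : C((U _⦋0⦌).left, T) ↦ φ x) hh⟩

end Descent

/-! ### The augmentation is an isomorphism of pro-objects -/

section Components

lemma piTop_hom_ext {X T : TopCat.{u}} {f g : piTop.obj X ⟶ T}
    (h : toPi.app X ≫ f = toPi.app X ≫ g) : f = g := by
  ext x
  obtain ⟨x, rfl⟩ := ConnectedComponents.surjective_coe x
  exact congrArg (fun φ ↦ φ x) h

variable {S : Scheme.{u}}

/-- The projection from the space `U₀` to `π(π₀(π(U)))`. -/
def toComponents (U : SimplicialObject S.ProEt) : Scheme.forgetToTop.obj (U _⦋0⦌).left ⟶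
    piTop.obj (pi0.obj ((simplicialPi S).obj U)) :=
  toPi.app _ ≫ toPi0 ((simplicialPi S).obj U) ≫ toPi.app _

lemma components_hom_ext {U : SimplicialObject S.ProEt} {T : TopCat.{u}}
    {f g : piTop.obj (pi0.obj ((simplicialPi S).obj U)) ⟶ T}
    (h : toComponents U ≫ f = toComponents U ≫ g) : f = g :=
  piTop_hom_ext (pi0_hom_ext (piTop_hom_ext h))

/-- The projection coequalises `U₁ ⇉ U₀`. -/
lemma δ_toComponents (U : SimplicialObject S.ProEt) :
    Scheme.forgetToTop.map (U.δ 0).left ≫ toComponents U =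
      Scheme.forgetToTop.map (U.δ 1).left ≫ toComponents U := by
  ext x
  exact congrArg (toPi.app _)
    (congrArg (fun φ ↦ φ (toPi.app (Scheme.forgetToTop.obj (U _⦋1⦌).left) x))
      (toPi0_condition ((simplicialPi S).obj U)))

lemma toComponents_augmentation (U : SimplicialObject S.ProEt) :
    toComponents U ≫ piLift (T := piTop.obj (Scheme.forgetToTop.obj S)) (augmentationPi0 U) =
      Scheme.forgetToTop.map (U _⦋0⦌).hom ≫ toPi.app _ := by
  ext x
  exact congrArg (fun φ ↦ φ (toPi.app (Scheme.forgetToTop.obj (U _⦋0⦌).left) x))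
    (toPi0_pi0Lift _ _ : toPi0 ((simplicialPi S).obj U) ≫ augmentationPi0 U = _)

/-- For a hypercovering `U` of `S`, the augmentation `π(π₀(π(U))) ⟶ π(S)` is a homeomorphism:
the space `S` is the coequaliser of `U₁ ⇉ U₀`, so that both sides have the same continuous maps
to totally disconnected spaces. -/
lemma isIso_piLift_augmentationPi0 {U : SimplicialObject S.ProEt} (hU : IsHypercovering U) :
    IsIso (piLift (T := piTop.obj (Scheme.forgetToTop.obj S)) (augmentationPi0 U)) := by
  obtain ⟨h, hh⟩ := exists_continuousMap_desc hU _ (δ_toComponents U)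
  refine ⟨piLift h, components_hom_ext ?_, piTop_hom_ext ?_⟩
  · ext x
    exact (congrArg (piLift h) (congrArg (fun φ ↦ φ x) (toComponents_augmentation U))).trans
      (congrArg (fun φ ↦ φ x) hh)
  · ext x
    obtain ⟨x, rfl⟩ := surjective_hom_of_isHypercovering hU x
    exact (congrArg (piLift (augmentationPi0 U)) (congrArg (fun φ ↦ φ x) hh)).trans
      (congrArg (fun φ ↦ φ x) (toComponents_augmentation U))

variable {S' : Scheme.{u}}

lemma toComponents_naturality {U' : SimplicialObject S'.ProEt} {U : SimplicialObject S.ProEt}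
    (φ : (simplicialPi S').obj U' ⟶ (simplicialPi S).obj U) (a : (U' _⦋0⦌).left ⟶ (U _⦋0⦌).left)
    (ha : φ.app (op ⦋0⦌) = piTop.map (Scheme.forgetToTop.map a)) :
    toComponents U' ≫ piTop.map (pi0.map φ) = Scheme.forgetToTop.map a ≫ toComponents U := by
  ext x
  have h₁ := congrArg (fun φ ↦ φ (toPi.app (Scheme.forgetToTop.obj (U' _⦋0⦌).left) x))
    (toPi0_map φ)
  have h₂ := congrArg (fun φ ↦ toPi0 ((simplicialPi S).obj U)
    (φ (toPi.app (Scheme.forgetToTop.obj (U' _⦋0⦌).left) x))) ha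
  exact congrArg (toPi.app _) (h₁.trans h₂)

/-- The augmentations are compatible with morphisms over `f : S' ⟶ S`. -/
lemma augmentation_naturality {f : S' ⟶ S} {U' : SimplicialObject S'.ProEt}
    {U : SimplicialObject S.ProEt} (φ : (simplicialPi S').obj U' ⟶ (simplicialPi S).obj U)
    (a : (U' _⦋0⦌).left ⟶ (U _⦋0⦌).left)
    (ha : φ.app (op ⦋0⦌) = piTop.map (Scheme.forgetToTop.map a))
    (w : a ≫ (U _⦋0⦌).hom = (U' _⦋0⦌).hom ≫ f) :
    piTop.map (pi0.map φ) ≫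
        piLift (T := piTop.obj (Scheme.forgetToTop.obj S)) (augmentationPi0 U) =
      piLift (T := piTop.obj (Scheme.forgetToTop.obj S')) (augmentationPi0 U') ≫
        piTop.map (Scheme.forgetToTop.map f) := by
  refine components_hom_ext ?_
  ext x
  have h₁ := congrArg (fun ψ ↦ piLift (T := piTop.obj (Scheme.forgetToTop.obj S))
    (augmentationPi0 U) (ψ x)) (toComponents_naturality φ a ha)
  have h₂ := congrArg (fun ψ ↦ ψ (a x)) (toComponents_augmentation U)
  have h₃ := congrArg (fun ψ : (U' _⦋0⦌).left ⟶ S ↦ toPi.app (Scheme.forgetToTop.obj S) (ψ x)) w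
  have h₄ := congrArg (fun ψ ↦ piTop.map (Scheme.forgetToTop.map f) (ψ x))
    (toComponents_augmentation U')
  exact h₁.trans (h₂.trans (h₃.trans h₄.symm))

variable {Ω : Type u} [Field Ω] {s : Spec (.of Ω) ⟶ S} {s' : Spec (.of Ω) ⟶ S'}

lemma isIso_augmentation (U : PointedHy s) : IsIso (augmentation U) := by
  have : IsIso ((Under.forget pt).map (augmentation U)) :=
    isIso_piLift_augmentationPi0 U.right.property
  exact isIso_of_reflects_iso _ (Under.forget pt)

/-- The augmentation of a pointed hypercovering, as an isomorphism of pointed spaces. -/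
def augmentationIso (U : HoPointedHy s) :
    (proEtComponents s).obj U ≅ piPt.obj (pointedSpace s) :=
  have := isIso_augmentation U.as
  asIso (augmentation U.as)

/-- The augmentations are natural with respect to morphisms of the homotopy category. -/
lemma map_augmentation {U V : HoPointedHy s} (φ : U ⟶ V) :
    (proEtComponents s).map φ ≫ augmentation V.as = augmentation U.as := by
  obtain ⟨φ, rfl⟩ := (CategoryTheory.Quotient.functor (homotopyRel
    (PointedHy.toSimplicial s))).map_surjective (X := U.as) (Y := V.as) φ
  refine Under.UnderMorphism.ext ?_
  have w : (φ.right.hom.app (op ⦋0⦌)).left ≫ (V.as.right.obj _⦋0⦌).hom =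
      (U.as.right.obj _⦋0⦌).hom ≫ 𝟙 S :=
    (MorphismProperty.Over.w (φ.right.hom.app (op ⦋0⦌))).trans (Category.comp_id _).symm
  refine (augmentation_naturality (f := 𝟙 S) ((simplicialPi S).map φ.right.hom)
    (φ.right.hom.app (op ⦋0⦌)).left rfl w).trans ?_
  exact (congrArg (piLift (T := piTop.obj (Scheme.forgetToTop.obj S))
    (augmentationPi0 U.as.right.obj) ≫ ·) (piTop.map_id _)).trans (Category.comp_id _)

/-- As the index category is cofiltered, the class of the augmentation of `U` in the colimit of the
`Hom(-, π(S))` does not depend on `U`. -/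
lemma germ_augmentation_eq (h : IsCofiltered (HoPointedHy s)) (U V : HoPointedHy s) :
    ProObject.Germ.mk (X := proComponents s h) U (augmentation U.as) =
      ProObject.Germ.mk (X := proComponents s h) V (augmentation V.as) := by
  have e {U V : HoPointedHy s} (φ : U ⟶ V) :
      ProObject.Germ.mk (X := proComponents s h) U (augmentation U.as) =
        ProObject.Germ.mk (X := proComponents s h) V (augmentation V.as) := by
    rw [← map_augmentation φ]
    exact ProObject.Germ.mk_map (X := proComponents s h) φ (augmentation V.as)
  exact (e (IsCofiltered.minToLeft U V)).symm.trans (e (IsCofiltered.minToRight U V))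

/-- The isomorphism of pro-objects given by the augmentations. -/
def proComponentsIso (h : IsCofiltered (HoPointedHy s)) (U₀ : PointedHy s) :
    proComponents s h ≅ ProObject.const (piPt.obj (pointedSpace s)) where
  hom :=
    { app _ := ProObject.Germ.mk (X := proComponents s h)
        ((CategoryTheory.Quotient.functor _).obj U₀) (augmentation U₀)
      naturality _ := ProObject.Germ.push_id _ }
  inv :=
    { app V := ProObject.Germ.mk (X := ProObject.const (piPt.obj (pointedSpace s)))
        ProObject.PointIndex.star (augmentationIso V).inv
      naturality {V W} φ := by
        refine congrArg (ProObject.Germ.mk (X := ProObject.const (piPt.obj (pointedSpace s)))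
          ProObject.PointIndex.star) ?_
        exact (Iso.inv_comp_eq _).2 ((Iso.eq_comp_inv _).2 (map_augmentation φ)) }
  hom_inv_id := by
    refine ProObject.Hom.ext (funext fun V ↦ ?_)
    refine (congrArg (ProObject.Germ.push (augmentationIso V).inv)
      (germ_augmentation_eq h ((CategoryTheory.Quotient.functor _).obj U₀) V)).trans ?_
    exact congrArg (ProObject.Germ.mk (X := proComponents s h) V) (augmentationIso V).hom_inv_id
  inv_hom_id := by
    refine ProObject.Hom.ext (funext fun _ ↦ ?_)
    exact congrArg (ProObject.Germ.mk (X := ProObject.const (piPt.obj (pointedSpace s)))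
      ProObject.PointIndex.star)
      (augmentationIso ((CategoryTheory.Quotient.functor _).obj U₀)).inv_hom_id

lemma components_augmentation {f : S' ⟶ S} (hf : s' ≫ f = s) {U' : PointedHy s'}
    {U : PointedHy s} (φ : PointedHy.HomOver f U' U) :
    φ.components ≫ augmentation U = augmentation U' ≫ piPt.map (pointedSpaceMap f hf) :=
  Under.UnderMorphism.ext
    (augmentation_naturality φ.pi.right (φ.app (op ⦋0⦌)) rfl (φ.w (op ⦋0⦌)))

end Components

end ProEtaleHomotopy

end

open ProEtaleHomotopy in
/-- Let `S` be a scheme with a geometric point `s`. The homotopy category of pointed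
hypercoverings of `(S, s)` is cofiltered, the pro-object `π ∘ π₀ ∘ Π(S, s)` of pointed spaces is
isomorphic to `π(S, s)` through the maps induced by the augmentations `U₀ ⟶ S`, and this is
natural in `(S, s)`. -/
theorem mainTheorem4 (S : Scheme.{u}) (Ω : Type u) [Field Ω] [IsSepClosed Ω]
    (s : Spec (.of Ω) ⟶ S) :
    (∃ (hc : IsCofiltered (HoPointedHy s))
      (e : proComponents s hc ≅ ProObject.const (piPt.obj (pointedSpace s))),
      ∀ U : PointedHy s,
        ProObject.Hom.app e.hom ProObject.PointIndex.star =
          ProObject.Germ.mk ((CategoryTheory.Quotient.functor _).obj U) (augmentation U)) ∧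
    ∀ (S' : Scheme.{u}) (s' : Spec (.of Ω) ⟶ S') (f : S' ⟶ S) (hf : s' ≫ f = s)
      (U' : PointedHy s') (U : PointedHy s) (φ : PointedHy.HomOver f U' U),
      φ.components ≫ augmentation U = augmentation U' ≫ piPt.map (pointedSpaceMap f hf) :=
  ⟨⟨isCofiltered_hoPointedHy s,
    proComponentsIso (isCofiltered_hoPointedHy s) (Classical.arbitrary _),
    fun _ ↦ germ_augmentation_eq _ _ _⟩,
  fun _ _ _ hf _ _ φ ↦ components_augmentation hf φ⟩
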